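/- Encode every nonnegative integer by a binary string, different integers receiving different strings. For $n\ge1$ let $Z_n$ be the number of $1$s in the code of an integer chosen uniformly at random from $\{0,1,\dots,n-1\}$. Assume that $Z_1=0$ and that, for every $n\ge 1$, $$Z_{2n}\stackrel{d}{=}Z_n+I,$$ where $I\sim\mathrm{Bernoulli}(1/2)$ is independent of $Z_n$. Write $\lambda=\lfloor\log_2 n\rfloor$, and let $$\Delta^r\binom{\lambda}{k}=\sum_{0\le\ell\le r}\binom r\ell(-1)^\ell\binom{\lambda}{k-\ell}$$ (a binomial coefficient with negative lower entry being $0$). For $n\ge1$ let $b_0(n),b_1(n),\dots$ be the Taylor coefficients at $y=1$ in $$\mathbb E\bigl(y^{Z_n}\bigr)\left(\frac{1+y}{2}\right)^{-\lambda}=\sum_{r\ge0}b_r(n)(y-1)^r ,$$ an expansion that is valid for $y$ in a neighbourhood of $1$. Let $$h_m=\frac{2^{m}}{\sqrt{2\pi}}\int_{-\infty}^{\infty}|H_m(x)|\,e^{-x^2/2}\,dx,\qquad H_m(x)=(-1)^m e^{x^2/2}\frac{d^m}{dx^m}e^{-x^2/2}.$$ Then $b_r(2n)=b_r(n)$ for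 all $r\ge0$ and $n\ge1$, and for every $m=1,2,\dots$ $$\sum_{0\le k\le\lambda}\left|\mathbb P(Z_n=k)-\sum_{0\le r<m}(-1)^r b_r(n)\,2^{-\lambda}\Delta^r\binom{\lambda}{k}\right|=\frac{h_m\,|b_m(n)|}{\lambda^{m/2}}+O\left(\lambda^{-(m+1)/2}\right)\qquad(n\ge2),$$ where the constant implied by $O$ depends only on $m$. -/

import Mathlib

open scoped Topology

noncomputable section

/-- A binary coding of the nonnegative integers: every integer is encoded by a binary string
(`true` is the digit `1`), and different integers have different codes. -/
structure BinaryCoding where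
  code : ℕ → List Bool
  code_injective : Function.Injective code

namespace BinaryCoding

/-- The number of `1`s in the code of `j`. -/
def ones (S : BinaryCoding) (j : ℕ) : ℕ := (S.code j).count true

/-- The law of `Z_n`, the number of `1`s in the code of an integer chosen uniformly at random from
`{0, 1, …, n - 1}`; by convention `Z_0 = 0`. -/
def law (S : BinaryCoding) (n : ℕ) : PMF ℕ :=
  if h : n = 0 then PMF.pure 0
  else (PMF.uniformOfFinset (Finset.range n) (Finset.nonempty_range_iff.mpr h)).map S.ones

/-- `ℙ(Z_n = k)`. -/
def prob (S : BinaryCoding) (n k : ℕ) : ℝ := (S.law n k).toReal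

/-- `𝔼(y ^ Z_n)`. -/
def pgf (S : BinaryCoding) (n : ℕ) (y : ℝ) : ℝ := ∫ z, y ^ z ∂(S.law n).toMeasure

/-- The function `𝔼(y ^ Z_n) ((1 + y) / 2) ^ (-λ)` with `λ = ⌊log₂ n⌋`. -/
def quotient (S : BinaryCoding) (n : ℕ) (y : ℝ) : ℝ :=
  S.pgf n y * (((1 + y) / 2) ^ Nat.log 2 n)⁻¹

/-- The coefficient `b_r(n)` of `(y - 1) ^ r` in the Taylor expansion at `y = 1` of
`𝔼(y ^ Z_n) ((1 + y) / 2) ^ (-λ)`. -/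
def coef (S : BinaryCoding) (r n : ℕ) : ℝ :=
  iteratedDeriv r (S.quotient n) 1 / (r.factorial : ℝ)

end BinaryCoding

/-- The Bernoulli law with parameter `1/2`: the values `0` and `1` are equally likely. -/
def fairBit : PMF ℕ := PMF.uniformOfFinset {0, 1} (Finset.insert_nonempty 0 {1})

/-- The law of the sum of two independent random variables with laws `p` and `q`. -/
def indepSum (p q : PMF ℕ) : PMF ℕ := p.bind fun a => q.map fun b => a + b

/-- `Z_{2n}` is distributed as `Z_n + I` for every `n ≥ 1`, where `I` is a Bernoulli variable with
parameter `1/2` that is independent of `Z_n`, and `Z_1 = 0`. -/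
structure BinaryCoding.IsDoubling (S : BinaryCoding) : Prop where
  law_one : S.law 1 = PMF.pure 0
  law_two_mul : ∀ n : ℕ, 1 ≤ n → S.law (2 * n) = indepSum (S.law n) fairBit

/-- The `r`-th backward difference in `k` of the binomial coefficient `L.choose k`,
`∑_{0 ≤ l ≤ r} (r.choose l) (-1) ^ l (L.choose (k - l))`, where `L.choose j` is `0` for negative
`j`. -/
def diffChoose (r L k : ℕ) : ℝ :=
  ∑ l ∈ Finset.range (r + 1),
    (r.choose l : ℝ) * (-1) ^ l * (if l ≤ k then (L.choose (k - l) : ℝ) else 0)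

/-- `h_m = (2 ^ m / √(2π)) ∫ |H_m(x)| exp(-x² / 2) dx`, with the Hermite polynomial
`H_m(x) = (-1) ^ m exp(x² / 2) (d/dx) ^ m exp(-x² / 2)`. -/
def hermiteConst (m : ℕ) : ℝ :=
  2 ^ m / Real.sqrt (2 * Real.pi) *
    ∫ x : ℝ, |Polynomial.aeval x (Polynomial.hermite m)| * Real.exp (-(x ^ 2) / 2)

namespace BinaryCoding

/-- The `ℓ¹` error on `{0, …, λ}`, `λ = ⌊log₂ n⌋`, of the expansion with `m` terms of the
distribution of `Z_n`. -/
def expansionError (S : BinaryCoding) (m n : ℕ) : ℝ :=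
  ∑ k ∈ Finset.range (Nat.log 2 n + 1),
    |S.prob n k - ∑ r ∈ Finset.range m,
      (-1) ^ r * S.coef r n * (2 ^ Nat.log 2 n)⁻¹ * diffChoose r (Nat.log 2 n) k|

end BinaryCoding

end

/-! Let `P_n = ∑_{j<n} X ^ ones j`, which is `n` times the generating function of `Z_n`, let `B = (1
+ X) / 2` and `L = ⌊log₂ n⌋`. The doubling hypothesis says `P_1 = 1` and `P_{2n} = 2 B P_n`. Reading
the binary digits of `n` from the top, `P_n` becomes a sum over `d ≤ L` of blocks `f_d (1 + X) ^ (L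
- d)`, where `f_d` has degree at most `d + 1` and coefficient norm at most `1`.

The Taylor expansion of `P_n / B ^ L` at `1` is produced algebraically: the operator `slopePoly L`
sends `f` to `(f - f(1) B ^ L) / (X - 1)`, and iterating it gives `f = ∑_{r<M} a_r (X - 1) ^ r B ^ L
+ (X - 1) ^ M R_M`. For `f = P_n` one gets `a_r = n b_r(n)`, and the coefficients of `(X - 1) ^ r B
^ L` are the differences in the theorem, so the error of the expansion is the coefficient norm of
the remainder, up to truncation at `k ≤ L`. The operator commutes with multiplication by powers of
`B`, so on a block it acts on `f_d` alone and costs only a power of `d + 1`; the geometric weights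
`2 ^ (L - d) / n ≤ 2 ^ (-d)` absorb it. Hence `M` terms leave an error `O(L ^ (-M/2))`
(`exists_expansionError_le`).

With `M = m + 1` the error after `m` terms is, up to `O(L ^ (-(m+1)/2))`, the `ℓ¹` size of the
single term `r = m`. That size is found in `exists_sum_abs_diffChoose_sub_le`: the coefficients of
`(1 - X) ^ m (1 + X) ^ L` are binomial coefficients times Krawtchouk polynomials, which are
`O(1/N)`-close to Hermite polynomials, and Stein's method gives the central limit theorem with rate
`O(N ^ (-1/2))` for the test function `|H_m|`. -/

/-! ### The simple random walk and its exponential moments -/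

/-- The expectation of `f (S_n)`, where `S_n` is the simple random walk after `n` steps. -/
noncomputable def walk (n : ℕ) (f : ℝ → ℝ) : ℝ :=
  (∑ ij ∈ Finset.HasAntidiagonal.antidiagonal n, (n.choose ij.1 : ℝ) * f ((ij.2 : ℝ) - ij.1)) / 2 ^ n

theorem walk_zero (f : ℝ → ℝ) : walk 0 f = f 0 := by
  simp [walk]

theorem walk_succ (n : ℕ) (f : ℝ → ℝ) :
    walk (n + 1) f = (walk n (fun s => f (s + 1)) + walk n (fun s => f (s - 1))) / 2 := by
  unfold walk
  have := Finset.sum_antidiagonal_choose_succ_mul (R := ℝ) (fun i j => f ((j : ℝ) - i)) n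
  rw [this]
  have h1 : ∀ ij ∈ Finset.HasAntidiagonal.antidiagonal n, (n.choose ij.1 : ℝ) * f (((ij.2 + 1 : ℕ) : ℝ) - ij.1)
      = n.choose ij.1 * f ((ij.2 : ℝ) - ij.1 + 1) := by
    intro ij _
    congr 2
    push_cast
    ring
  have h2 : ∀ ij ∈ Finset.HasAntidiagonal.antidiagonal n, (n.choose ij.2 : ℝ) * f ((ij.2 : ℝ) - (ij.1 + 1 : ℕ))
      = n.choose ij.1 * f ((ij.2 : ℝ) - ij.1 - 1) := by
    intro ij h
    rw [Finset.HasAntidiagonal.mem_antidiagonal] at h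
    rw [← Nat.choose_symm_of_eq_add h.symm]
    congr 2
    push_cast
    ring
  rw [Finset.sum_congr rfl h1, Finset.sum_congr rfl h2, pow_succ]
  field_simp

theorem walk_add (n : ℕ) (f g : ℝ → ℝ) :
    walk n (fun s => f s + g s) = walk n f + walk n g := by
  simp only [walk, mul_add, Finset.sum_add_distrib, add_div]

theorem walk_const_mul (n : ℕ) (c : ℝ) (f : ℝ → ℝ) :
    walk n (fun s => c * f s) = c * walk n f := by
  simp only [walk, mul_left_comm _ c, ← Finset.mul_sum, mul_div_assoc]

theorem walk_sub (n : ℕ) (f g : ℝ → ℝ) :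
    walk n (fun s => f s - g s) = walk n f - walk n g := by
  simp only [walk, mul_sub, Finset.sum_sub_distrib, sub_div]

theorem walk_mono (n : ℕ) {f g : ℝ → ℝ} (h : ∀ s, f s ≤ g s) : walk n f ≤ walk n g := by
  unfold walk
  gcongr
  exact h _

theorem walk_nonneg (n : ℕ) {f : ℝ → ℝ} (h : ∀ s, 0 ≤ f s) : 0 ≤ walk n f :=
  div_nonneg (Finset.sum_nonneg fun _ _ => mul_nonneg (Nat.cast_nonneg _) (h _)) (by positivity)

theorem abs_walk_le (n : ℕ) (f : ℝ → ℝ) : |walk n f| ≤ walk n (fun s => |f s|) := by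
  unfold walk
  rw [abs_div, abs_of_pos (by positivity : (0 : ℝ) < 2 ^ n)]
  gcongr
  refine (Finset.abs_sum_le_sum_abs _ _).trans_eq ?_
  simp [abs_mul]

theorem walk_const (n : ℕ) (c : ℝ) : walk n (fun _ => c) = c := by
  induction n with
  | zero => exact walk_zero _
  | succ n ih => rw [walk_succ, ih]; ring

/-- Summation by parts for the simple random walk. -/
theorem walk_succ_id_mul (n : ℕ) (f : ℝ → ℝ) :
    walk (n + 1) (fun s => s * f s)
      = (n + 1) / 2 * walk n (fun s => f (s + 1) - f (s - 1)) := by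
  induction n generalizing f with
  | zero => simp [walk_succ, walk_zero]; ring_nf
  | succ n ih =>
    have e1 : (fun s : ℝ => (s + 1) * f (s + 1)) = fun s => s * f (s + 1) + f (s + 1) := by
      ext; ring
    have e2 : (fun s : ℝ => (s - 1) * f (s - 1)) = fun s => s * f (s - 1) - f (s - 1) := by
      ext; ring
    rw [walk_succ, e1, e2, walk_add, walk_sub (n + 1) (fun s => s * f (s - 1)),
      ih (fun s => f (s + 1)), ih (fun s => f (s - 1)), walk_sub (n + 1),
      walk_succ n (fun s => f (s + 1)), walk_succ n (fun s => f (s - 1)), walk_sub n, walk_sub n]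
    push_cast
    ring_nf

theorem walk_exp (n : ℕ) (t : ℝ) : walk n (fun s => Real.exp (t * s)) = Real.cosh t ^ n := by
  induction n with
  | zero => simp [walk_zero]
  | succ n ih =>
    have e1 : (fun s : ℝ => Real.exp (t * (s + 1))) = fun s => Real.exp t * Real.exp (t * s) := by
      ext s; rw [← Real.exp_add]; ring_nf
    have e2 : (fun s : ℝ => Real.exp (t * (s - 1)))
        = fun s => Real.exp (-t) * Real.exp (t * s) := by
      ext s; rw [← Real.exp_add]; ring_nf
    rw [walk_succ, e1, e2, walk_const_mul, walk_const_mul, ih, pow_succ, Real.cosh_eq]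
    ring

/-- Sub-Gaussian bound from `cosh t ≤ exp (t² / 2)`. At `t` of order `n ^ (-1/2)` it is uniform in
`n`, so functions of exponential growth of the normalised walk have bounded expectations. -/
theorem walk_exp_abs_le (n : ℕ) (t : ℝ) :
    walk n (fun s => Real.exp (t * |s|)) ≤ 2 * Real.exp (n * t ^ 2 / 2) := by
  have h1 : ∀ s : ℝ, Real.exp (t * |s|) ≤ Real.exp (t * s) + Real.exp (-t * s) := by
    intro s
    rcases abs_cases s with ⟨h, _⟩ | ⟨h, _⟩ <;> rw [h]
    · linarith [Real.exp_pos (-t * s)]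
    · rw [mul_neg, ← neg_mul]
      linarith [Real.exp_pos (t * s)]
  refine (walk_mono n h1).trans ?_
  rw [walk_add, walk_exp, walk_exp, Real.cosh_neg, ← two_mul]
  gcongr
  calc Real.cosh t ^ n ≤ Real.exp (t ^ 2 / 2) ^ n := by
        gcongr
        exact Real.cosh_le_exp_half_sq t
    _ = _ := by rw [← Real.exp_nat_mul]; ring_nf

/-! ### Test functions of exponential growth -/

/-- `f` is locally Lipschitz, with a constant that grows at most exponentially. -/
def ExpLipschitz (K c : ℝ) (f : ℝ → ℝ) : Prop :=
  ∀ x y, |f x - f y| ≤ K * Real.exp (c * max |x| |y|) * |x - y|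

theorem ExpLipschitz.continuous {K c : ℝ} {f : ℝ → ℝ} (hf : ExpLipschitz K c f) :
    Continuous f := by
  rw [continuous_iff_continuousAt]
  intro x
  rw [ContinuousAt, tendsto_iff_dist_tendsto_zero]
  refine squeeze_zero (fun _ => dist_nonneg) (fun y => hf y x) ?_
  have : Continuous fun y => K * Real.exp (c * max |y| |x|) * |y - x| := by fun_prop
  simpa using this.tendsto x

theorem ExpLipschitz.abs_le {K c : ℝ} {f : ℝ → ℝ} (hf : ExpLipschitz K c f) (hK : 0 ≤ K)
    (hc : 0 ≤ c) (x : ℝ) : |f x| ≤ (|f 0| + K) * Real.exp ((c + 1) * |x|) := by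
  have h1 := hf x 0
  simp only [abs_zero, sub_zero, max_eq_left (abs_nonneg x)] at h1
  have h2 : |x| ≤ Real.exp |x| := by linarith [Real.add_one_le_exp |x|]
  have h3 : 1 ≤ Real.exp ((c + 1) * |x|) := Real.one_le_exp (by positivity)
  have h4 : |f x| ≤ |f 0| + |f x - f 0| := by
    linarith [abs_sub_abs_le_abs_sub (f x) (f 0)]
  calc |f x| ≤ |f 0| * 1 + K * Real.exp (c * |x|) * Real.exp |x| := by
        rw [mul_one]; refine h4.trans ?_; gcongr; exact h1.trans (by gcongr)
    _ ≤ |f 0| * Real.exp ((c + 1) * |x|) + K * Real.exp ((c + 1) * |x|) := by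
        rw [mul_assoc, ← Real.exp_add, add_mul c, one_mul]
        rw [add_mul c, one_mul] at h3
        gcongr
    _ = _ := by ring

theorem expLipschitz_of_hasDerivAt {K c : ℝ} {f f' : ℝ → ℝ} (hK : 0 ≤ K) (hc : 0 ≤ c)
    (hf : ∀ x, HasDerivAt f (f' x) x) (hf' : ∀ x, |f' x| ≤ K * Real.exp (c * |x|)) :
    ExpLipschitz K c f := by
  intro x y
  set R := max |x| |y|
  have := (convex_Icc (-R) R).norm_image_sub_le_of_norm_hasDerivWithin_le (f := f) (f' := f')
    (C := K * Real.exp (c * R)) (x := y) (y := x) (fun z _ => (hf z).hasDerivWithinAt)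
    (fun z hz => (hf' z).trans (by gcongr; exact abs_le.mpr hz))
    (abs_le.mp (le_max_right _ _)) (abs_le.mp (le_max_left _ _))
  simpa using this

theorem ExpLipschitz.add {K K' c : ℝ} {f g : ℝ → ℝ} (hf : ExpLipschitz K c f)
    (hg : ExpLipschitz K' c g) : ExpLipschitz (K + K') c (fun x => f x + g x) := by
  intro x y
  have h : f x + g x - (f y + g y) = (f x - f y) + (g x - g y) := by ring
  rw [h, add_mul, add_mul]
  exact (abs_add_le _ _).trans (add_le_add (hf x y) (hg x y))

theorem ExpLipschitz.mono {K K' c c' : ℝ} {f : ℝ → ℝ} (hf : ExpLipschitz K c f) (hK : 0 ≤ K)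
    (hK' : K ≤ K') (hc : c ≤ c') : ExpLipschitz K' c' f := fun x y =>
  (hf x y).trans (by gcongr; exact hK.trans hK')

/-! ### Gaussian integrals and Stein's equation -/

theorem exp_mul_abs_le (a x : ℝ) :
    Real.exp (a * |x|) ≤ Real.exp (a * x) + Real.exp (-a * x) := by
  rcases abs_cases x with ⟨h, _⟩ | ⟨h, _⟩ <;> rw [h]
  · linarith [Real.exp_pos (-a * x)]
  · rw [mul_neg, ← neg_mul]
    linarith [Real.exp_pos (a * x)]

theorem integrable_exp_mul_mul_gauss (a : ℝ) :
    MeasureTheory.Integrable fun t : ℝ => Real.exp (a * t) * Real.exp (-(t ^ 2) / 2) := by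
  have h := ((integrable_exp_neg_mul_sq (by norm_num : (0 : ℝ) < 1 / 2)).comp_sub_right a).const_mul
    (Real.exp (a ^ 2 / 2))
  refine h.congr (Filter.Eventually.of_forall fun t => ?_)
  simp only [← Real.exp_add]
  ring_nf

theorem integrable_exp_mul_abs_mul_gauss (a : ℝ) :
    MeasureTheory.Integrable fun t : ℝ => Real.exp (a * |t|) * Real.exp (-(t ^ 2) / 2) := by
  refine ((integrable_exp_mul_mul_gauss a).add (integrable_exp_mul_mul_gauss (-a))).mono'
    (by fun_prop) (Filter.Eventually.of_forall fun t => ?_)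
  rw [Real.norm_of_nonneg (by positivity), Pi.add_apply, ← add_mul]
  gcongr
  exact exp_mul_abs_le a t

theorem integrable_mul_gauss {A a : ℝ} {f : ℝ → ℝ} (hf : Continuous f)
    (hA : ∀ x, |f x| ≤ A * Real.exp (a * |x|)) :
    MeasureTheory.Integrable fun t : ℝ => f t * Real.exp (-(t ^ 2) / 2) := by
  refine ((integrable_exp_mul_abs_mul_gauss a).const_mul A).mono'
    (by fun_prop) (Filter.Eventually.of_forall fun t => ?_)
  rw [norm_mul, Real.norm_eq_abs, Real.norm_of_nonneg (Real.exp_pos _).le, ← mul_assoc]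
  gcongr
  exact hA t

/-- A solution of Stein's equation `g' - x g = f` that grows no faster than `f`. -/
theorem exists_stein_solution {A a : ℝ} {f : ℝ → ℝ} (ha : 0 ≤ a) (hf : Continuous f)
    (hA : ∀ x, |f x| ≤ A * Real.exp (a * |x|))
    (h0 : ∫ t : ℝ, f t * Real.exp (-(t ^ 2) / 2) = 0) :
    ∃ g : ℝ → ℝ, (∀ x, HasDerivAt g (f x + x * g x) x) ∧
      ∃ K, 0 ≤ K ∧ ∀ x, |g x| ≤ K * Real.exp (a * |x|) := by
  have hA0 : 0 ≤ A := by simpa using (abs_nonneg _).trans (hA 0)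
  set u : ℝ → ℝ := fun t => f t * Real.exp (-(t ^ 2) / 2)
  have hu : MeasureTheory.Integrable u := integrable_mul_gauss hf hA
  have huc : Continuous u := by fun_prop
  set F : ℝ → ℝ := fun x => ∫ t in Set.Iic x, u t
  have hF : ∀ x, HasDerivAt F (u x) x := by
    intro x
    have h1 : F = fun x => (∫ t in (0 : ℝ)..x, u t) + F 0 := by
      ext y
      rw [← intervalIntegral.integral_Iic_sub_Iic hu.integrableOn hu.integrableOn]
      simp [F]
    rw [h1]
    exact (intervalIntegral.integral_hasDerivAt_right (huc.intervalIntegrable _ _)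
      (huc.stronglyMeasurableAtFilter _ _) huc.continuousAt).add_const _
  -- As `f` has Gaussian mean zero, `F` is an integral over either half-line; the one on the side of
  -- `x` away from `0` is used for the bound.
  have hF2 : ∀ x, F x = - ∫ t in Set.Ioi x, u t := by
    intro x
    have := MeasureTheory.integral_add_compl (measurableSet_Iic (a := x)) hu
    rw [h0, Set.compl_Iic] at this
    simp only [F]
    linarith
  set J : ℝ := ∫ s : ℝ, Real.exp (a * |s|) * Real.exp (-(s ^ 2) / 2)
  have hJ : 0 ≤ J := MeasureTheory.integral_nonneg fun s => by positivity
  -- Beyond `x`, seen from `0`, one has `t² ≥ x² + (t - x)²`. This extracts the factor `exp (-x² /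
  -- 2)` that cancels the integrating factor `exp (x² / 2)` of the solution.
  have key : ∀ x t : ℝ, 0 ≤ x * (t - x) →
      |u t| ≤ Real.exp (-(x ^ 2) / 2) * (A * Real.exp (a * |x|) *
        (Real.exp (a * |t - x|) * Real.exp (-((t - x) ^ 2) / 2))) := by
    intro x t hx
    have e : |u t| = |f t| * Real.exp (-(t ^ 2) / 2) := by
      simp only [u, abs_mul, abs_of_pos (Real.exp_pos _)]
    have h2 : |t| ≤ |x| + |t - x| := by
      have := abs_add_le x (t - x); simpa using this
    rw [e]
    calc |f t| * Real.exp (-(t ^ 2) / 2)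
        ≤ (A * Real.exp (a * (|x| + |t - x|))) *
          Real.exp (-(x ^ 2) / 2 + -((t - x) ^ 2) / 2) := by
          refine mul_le_mul ((hA t).trans (by gcongr)) (Real.exp_le_exp.mpr ?_)
            (Real.exp_pos _).le (by positivity)
          nlinarith
      _ = _ := by rw [mul_add, Real.exp_add, Real.exp_add]; ring
  have hint : ∀ x : ℝ, MeasureTheory.Integrable fun t : ℝ =>
      Real.exp (-(x ^ 2) / 2) * (A * Real.exp (a * |x|) *
        (Real.exp (a * |t - x|) * Real.exp (-((t - x) ^ 2) / 2))) := fun x =>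
    (((integrable_exp_mul_abs_mul_gauss a).comp_sub_right x).const_mul _).const_mul _
  have hval : ∀ x : ℝ, ∫ t : ℝ, Real.exp (-(x ^ 2) / 2) * (A * Real.exp (a * |x|) *
        (Real.exp (a * |t - x|) * Real.exp (-((t - x) ^ 2) / 2)))
      = Real.exp (-(x ^ 2) / 2) * (A * Real.exp (a * |x|) * J) := by
    intro x
    rw [MeasureTheory.integral_const_mul, MeasureTheory.integral_const_mul,
      MeasureTheory.integral_sub_right_eq_self
        (fun s : ℝ => Real.exp (a * |s|) * Real.exp (-(s ^ 2) / 2)) x]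
  have bound : ∀ (x : ℝ) (s : Set ℝ), MeasurableSet s → (∀ t ∈ s, 0 ≤ x * (t - x)) →
      |∫ t in s, u t| ≤ Real.exp (-(x ^ 2) / 2) * (A * Real.exp (a * |x|) * J) := by
    intro x s hs hx
    refine (MeasureTheory.norm_integral_le_integral_norm (μ := MeasureTheory.volume.restrict s)
      u).trans ?_
    rw [← hval]
    refine (MeasureTheory.setIntegral_mono_on hu.norm.integrableOn (hint x).integrableOn hs
      fun t ht => key x t (hx t ht)).trans ?_
    exact MeasureTheory.setIntegral_le_integral (hint x)
      (Filter.Eventually.of_forall fun t => by positivity)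
  have hFb : ∀ x, |F x| ≤ Real.exp (-(x ^ 2) / 2) * (A * Real.exp (a * |x|) * J) := by
    intro x
    rcases le_total 0 x with h | h
    · rw [hF2, abs_neg]
      exact bound x _ measurableSet_Ioi fun t ht =>
        mul_nonneg h (sub_nonneg.mpr (Set.mem_Ioi.mp ht).le)
    · exact bound x _ measurableSet_Iic fun t ht =>
        mul_nonneg_of_nonpos_of_nonpos h (sub_nonpos.mpr (Set.mem_Iic.mp ht))
  refine ⟨fun x => Real.exp (x ^ 2 / 2) * F x, fun x => ?_, A * J, by positivity, fun x => ?_⟩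
  · have h1 : HasDerivAt (fun x : ℝ => Real.exp (x ^ 2 / 2)) (Real.exp (x ^ 2 / 2) * x) x := by
      have := ((hasDerivAt_pow 2 x).div_const 2).exp
      convert! this using 1
      push_cast; ring
    convert! h1.mul (hF x) using 1
    have : Real.exp (x ^ 2 / 2) * Real.exp (-(x ^ 2) / 2) = 1 := by
      rw [← Real.exp_add, neg_div, add_neg_cancel, Real.exp_zero]
    simp only [u]
    linear_combination (-f x) * this
  · rw [abs_mul, abs_of_pos (Real.exp_pos _)]
    refine (mul_le_mul_of_nonneg_left (hFb x) (Real.exp_pos _).le).trans_eq ?_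
    have : Real.exp (x ^ 2 / 2) * Real.exp (-(x ^ 2) / 2) = 1 := by
      rw [← Real.exp_add, neg_div, add_neg_cancel, Real.exp_zero]
    rw [← mul_assoc, this]
    ring

theorem integral_gauss : ∫ t : ℝ, Real.exp (-(t ^ 2) / 2) = Real.sqrt (2 * Real.pi) := by
  have h := integral_gaussian (1 / 2)
  rw [show Real.pi / (1 / 2) = 2 * Real.pi by ring] at h
  rw [← h]
  congr 1
  ext t
  ring_nf

theorem sq_le_two_mul_exp_abs (x : ℝ) : x ^ 2 ≤ 2 * Real.exp |x| := by
  have := Real.quadratic_le_exp_of_nonneg (abs_nonneg x)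
  rw [sq_abs] at this
  linarith [abs_nonneg x]

theorem abs_le_exp_abs (x : ℝ) : |x| ≤ Real.exp |x| := by
  linarith [Real.add_one_le_exp |x|]

/-! ### The central limit theorem with a rate -/

/-- The rate of convergence in the central limit theorem for the simple random walk. -/
theorem exists_walk_sub_gauss_le {K c : ℝ} {f : ℝ → ℝ} (hK : 0 ≤ K) (hc : 0 ≤ c)
    (hf : ExpLipschitz K c f) :
    ∃ C, ∀ n : ℕ, |walk (n + 1) (fun s => f (s / Real.sqrt ((n : ℝ) + 1))) -
        (∫ t : ℝ, f t * Real.exp (-(t ^ 2) / 2)) / Real.sqrt (2 * Real.pi)|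
      ≤ C / Real.sqrt ((n : ℝ) + 1) := by
  set μ := (∫ t : ℝ, f t * Real.exp (-(t ^ 2) / 2)) / Real.sqrt (2 * Real.pi) with hμ
  set f0 : ℝ → ℝ := fun x => f x - μ
  have hf0 : ExpLipschitz K c f0 := fun x y => by simpa [f0] using hf x y
  have ha : 0 ≤ c + 1 := by linarith
  have hb := hf0.abs_le hK hc
  set A := |f0 0| + K
  have hA : 0 ≤ A := by positivity
  have hint0 : ∫ t : ℝ, f0 t * Real.exp (-(t ^ 2) / 2) = 0 := by
    have e : (fun t : ℝ => f0 t * Real.exp (-(t ^ 2) / 2))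
        = fun t => f t * Real.exp (-(t ^ 2) / 2) - μ * Real.exp (-(t ^ 2) / 2) := by
      ext t; simp only [f0]; ring
    have h1 := integrable_mul_gauss hf.continuous (hf.abs_le hK hc)
    have h2 : MeasureTheory.Integrable fun t : ℝ => Real.exp (-(t ^ 2) / 2) := by
      simpa using integrable_exp_mul_mul_gauss 0
    rw [e, MeasureTheory.integral_sub h1 (h2.const_mul μ), MeasureTheory.integral_const_mul,
      integral_gauss, hμ, div_mul_cancel₀, sub_self]
    positivity
  obtain ⟨g, hg, B, hB, hgB⟩ := exists_stein_solution ha hf0.continuous hb hint0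
  -- By Stein's equation `G` is the derivative of `g`. It is exponentially Lipschitz because `(x g)'
  -- = g + x f0 + x² g` grows at most exponentially.
  set G : ℝ → ℝ := fun x => f0 x + x * g x
  obtain ⟨M, d, hM, hd, hG⟩ : ∃ M d, 0 ≤ M ∧ 0 ≤ d ∧ ExpLipschitz M d G := by
    have hxg : ExpLipschitz (B + A + 2 * B) (c + 2) (fun x => x * g x) := by
      refine expLipschitz_of_hasDerivAt (by positivity) (by positivity)
        (fun x => (hasDerivAt_id x).mul (hg x)) fun x => ?_
      have e : Real.exp ((c + 2) * |x|) = Real.exp ((c + 1) * |x|) * Real.exp |x| := by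
        rw [← Real.exp_add]; ring_nf
      have h1 : 1 ≤ Real.exp |x| := Real.one_le_exp (abs_nonneg x)
      have t1 : |g x| ≤ B * Real.exp ((c + 2) * |x|) := by
        refine (hgB x).trans ?_
        gcongr
        linarith
      have t2 : |x * f0 x| ≤ A * Real.exp ((c + 2) * |x|) := by
        rw [abs_mul, e]
        calc |x| * |f0 x| ≤ Real.exp |x| * (A * Real.exp ((c + 1) * |x|)) := by
              gcongr
              · exact abs_le_exp_abs x
              · exact hb x
          _ = _ := by ring
      have t3 : |x ^ 2 * g x| ≤ 2 * B * Real.exp ((c + 2) * |x|) := by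
        rw [abs_mul, e, abs_of_nonneg (sq_nonneg x)]
        calc x ^ 2 * |g x| ≤ 2 * Real.exp |x| * (B * Real.exp ((c + 1) * |x|)) := by
              gcongr
              · exact sq_le_two_mul_exp_abs x
              · exact hgB x
          _ = _ := by ring
      have e2 : 1 * g x + id x * (f0 x + x * g x) = g x + x * f0 x + x ^ 2 * g x := by
        simp only [id]; ring
      rw [e2, add_mul, add_mul]
      exact (abs_add_le _ _).trans (add_le_add ((abs_add_le _ _).trans (add_le_add t1 t2)) t3)
    exact ⟨K + (B + A + 2 * B), c + 2, by positivity, by positivity,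
      (hf0.mono hK le_rfl (by linarith)).add hxg⟩
  refine ⟨2 * M * Real.exp d * (2 * Real.exp (d ^ 2 / 2)), fun n => ?_⟩
  set q := Real.sqrt ((n : ℝ) + 1)
  have hq1 : 1 ≤ q := by
    rw [Real.one_le_sqrt]
    linarith [(Nat.cast_nonneg n : (0 : ℝ) ≤ n)]
  have hq : 0 < q := by linarith
  have hqq : q * q = n + 1 := Real.mul_self_sqrt (by positivity)
  -- Write `f0 = G - x g`. Summation by parts turns the expectation of `x g` into that of a
  -- difference quotient of `g` over a step `2 / q`, while the last step of the walk averages `G`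
  -- over the same two endpoints.
  have e1 : walk (n + 1) (fun s => f (s / q)) - μ
      = walk n (fun s => (G ((s + 1) / q) + G ((s - 1) / q)) / 2
          - (g ((s + 1) / q) - g ((s - 1) / q)) / (2 / q)) := by
    have e2 : walk (n + 1) (fun s => f (s / q)) - μ
        = walk (n + 1) (fun s => G (s / q) - (1 / q) * (s * g (s / q))) := by
      rw [← walk_const (n + 1) μ, ← walk_sub]
      congr 1
      ext s
      simp only [G, f0]
      ring
    rw [e2, walk_sub, walk_const_mul, walk_succ_id_mul n (fun s => g (s / q)), walk_succ,
      ← walk_add, ← hqq]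
    have e3 : (fun s => (G ((s + 1) / q) + G ((s - 1) / q)) / 2
          - (g ((s + 1) / q) - g ((s - 1) / q)) / (2 / q))
        = fun s => (1 / 2) * (G ((s + 1) / q) + G ((s - 1) / q))
          - (q / 2) * (g ((s + 1) / q) - g ((s - 1) / q)) := by
      ext s
      field_simp
    rw [e3, walk_sub n (fun s => (1 / 2) * (G ((s + 1) / q) + G ((s - 1) / q))), walk_const_mul,
      walk_const_mul, walk_sub n (fun s => g ((s + 1) / q))]
    field_simp
  rw [e1]
  have hpt : ∀ s : ℝ, |(G ((s + 1) / q) + G ((s - 1) / q)) / 2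
          - (g ((s + 1) / q) - g ((s - 1) / q)) / (2 / q)|
      ≤ (2 * M * Real.exp d / q) * Real.exp (d / q * |s|) := by
    intro s
    have hlt : (s - 1) / q < (s + 1) / q := by gcongr; linarith
    -- The difference quotient equals `G ξ` for an intermediate `ξ`, so only the oscillation of `G`
    -- over an interval of length `2 / q` remains.
    obtain ⟨ξ, ⟨hξ1, hξ2⟩, hξ⟩ := exists_hasDerivAt_eq_slope g G hlt
      (fun x _ => (hg x).continuousAt.continuousWithinAt) (fun x _ => hg x)
    have e4 : (s + 1) / q - (s - 1) / q = 2 / q := by ring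
    rw [e4] at hξ
    rw [← hξ]
    have hs : |s / q| = |s| / q := by rw [abs_div, abs_of_pos hq]
    have near : ∀ z, (s - 1) / q ≤ z → z ≤ (s + 1) / q → |z| ≤ |s| / q + 1 := by
      intro z h1 h2
      have h3 : |z - s / q| ≤ 1 := by
        have : 1 / q ≤ 1 := by rw [div_le_one hq]; exact hq1
        rw [sub_div] at h1
        rw [add_div] at h2
        rw [abs_le]
        constructor <;> linarith
      have := abs_add_le (s / q) (z - s / q)
      rw [add_sub_cancel, hs] at this
      linarith
    have diff : ∀ z, (s - 1) / q ≤ z → z ≤ (s + 1) / q →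
        |G z - G ξ| ≤ M * Real.exp (d * (|s| / q + 1)) * (2 / q) := by
      intro z h1 h2
      refine (hG z ξ).trans ?_
      gcongr
      · exact max_le (near z h1 h2) (near ξ hξ1.le hξ2.le)
      · rw [← e4, abs_le]
        constructor <;> linarith
    have d1 := diff _ hlt.le le_rfl
    have d2 := diff _ le_rfl hlt.le
    have e5 : (G ((s + 1) / q) + G ((s - 1) / q)) / 2 - G ξ
        = ((G ((s + 1) / q) - G ξ) + (G ((s - 1) / q) - G ξ)) / 2 := by ring
    rw [e5, abs_div, abs_two]
    have e6 : 2 * M * Real.exp d / q * Real.exp (d / q * |s|)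
        = M * Real.exp (d * (|s| / q + 1)) * (2 / q) := by
      rw [mul_add, Real.exp_add, mul_one, show d / q * |s| = d * (|s| / q) by ring]
      ring
    rw [e6]
    have := abs_add_le (G ((s + 1) / q) - G ξ) (G ((s - 1) / q) - G ξ)
    linarith
  refine (abs_walk_le _ _).trans ((walk_mono n hpt).trans ?_)
  rw [walk_const_mul]
  have hw := walk_exp_abs_le n (d / q)
  have h6 : (n : ℝ) * (d / q) ^ 2 / 2 ≤ d ^ 2 / 2 := by
    have : (n : ℝ) * (d / q) ^ 2 ≤ d ^ 2 := by
      rw [div_pow, sq q, hqq, ← mul_div_assoc, div_le_iff₀ (by positivity)]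
      nlinarith [sq_nonneg d]
    linarith
  calc 2 * M * Real.exp d / q * walk n (fun s => Real.exp (d / q * |s|))
      ≤ 2 * M * Real.exp d / q * (2 * Real.exp (d ^ 2 / 2)) := by
        gcongr
        exact hw.trans (by gcongr)
    _ = _ := by ring

/-! ### Hermite and Krawtchouk polynomials -/

open Polynomial in
theorem derivative_hermite_succ (n : ℕ) :
    derivative (hermite (n + 1)) = ((n + 1 : ℕ) : ℤ[X]) * hermite n := by
  induction n with
  | zero => simp
  | succ n ih =>
    rw [hermite_succ (n + 1), derivative_sub, derivative_mul, derivative_X, ih, derivative_mul,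
      hermite_succ n]
    simp only [derivative_natCast]
    push_cast
    ring

/-- The value at `x` of the `m`-th Hermite polynomial. -/
noncomputable def hermiteValue (m : ℕ) (x : ℝ) : ℝ := Polynomial.aeval x (Polynomial.hermite m)

theorem hermiteValue_add_two (m : ℕ) (x : ℝ) :
    hermiteValue (m + 2) x = x * hermiteValue (m + 1) x - (m + 1) * hermiteValue m x := by
  unfold hermiteValue
  rw [Polynomial.hermite_succ (m + 1), derivative_hermite_succ]
  simp

/-- The Krawtchouk polynomials for `N` fair coin tosses, normalised so that they tend to the
Hermite polynomials as `N` tends to infinity. -/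
noncomputable def krawtchouk (N x : ℝ) : ℕ → ℝ
  | 0 => 1
  | 1 => x
  | m + 2 => (x * krawtchouk N x (m + 1) - (m + 1) * krawtchouk N x m) / (1 - (m + 1) / N)

theorem abs_hermiteValue_le (m : ℕ) :
    ∃ C, 0 ≤ C ∧ ∀ x, |hermiteValue m x| ≤ C * Real.exp (m * |x|) := by
  induction m using Nat.strong_induction_on with
  | _ m ih =>
    match m with
    | 0 => exact ⟨1, zero_le_one, fun x => by simp [hermiteValue]⟩
    | 1 => exact ⟨1, zero_le_one, fun x => by simpa [hermiteValue] using abs_le_exp_abs x⟩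
    | m + 2 =>
      obtain ⟨A, hA, h1⟩ := ih (m + 1) (by omega)
      obtain ⟨B, hB, h0⟩ := ih m (by omega)
      refine ⟨A + (m + 1) * B, by positivity, fun x => ?_⟩
      have e1 : Real.exp (((m + 2 : ℕ) : ℝ) * |x|)
          = Real.exp |x| * Real.exp (((m + 1 : ℕ) : ℝ) * |x|) := by
        rw [← Real.exp_add]; push_cast; ring_nf
      have e2 : Real.exp ((m : ℝ) * |x|) ≤ Real.exp (((m + 2 : ℕ) : ℝ) * |x|) := by
        gcongr; omega
      rw [hermiteValue_add_two]
      refine (norm_sub_le (_ : ℝ) _).trans ?_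
      rw [Real.norm_eq_abs, Real.norm_eq_abs, abs_mul, abs_mul,
        abs_of_nonneg (by positivity : (0 : ℝ) ≤ m + 1), add_mul A]
      refine add_le_add ?_ ?_
      · rw [e1]
        calc _ ≤ Real.exp |x| * (A * Real.exp (((m + 1 : ℕ) : ℝ) * |x|)) := by
              gcongr
              · exact abs_le_exp_abs x
              · exact h1 x
          _ = _ := by ring
      · calc _ ≤ ((m : ℝ) + 1) * (B * Real.exp (((m + 2 : ℕ) : ℝ) * |x|)) := by
              gcongr
              exact (h0 x).trans (by gcongr)
          _ = _ := by ring

/-- The two three-term recurrences differ only by the factor `δ = 1 - (m + 1) / N`, so the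
difference satisfies the Krawtchouk recurrence with a source term `(m + 1) / N * H_{m+2}`. The
condition `m ≤ N` keeps the denominators away from `0`. -/
theorem abs_krawtchouk_sub_hermiteValue_le (m : ℕ) :
    ∃ C, 0 ≤ C ∧ ∀ N : ℕ, 1 ≤ N → m ≤ N → ∀ x,
      |krawtchouk N x m - hermiteValue m x| ≤ C / N * Real.exp (m * |x|) := by
  induction m using Nat.strong_induction_on with
  | _ m ih =>
    match m with
    | 0 => exact ⟨0, le_rfl, fun N _ _ x => by simp [hermiteValue, krawtchouk]⟩
    | 1 => exact ⟨0, le_rfl, fun N _ _ x => by simp [hermiteValue, krawtchouk]⟩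
    | m + 2 =>
      obtain ⟨A, hA, h1⟩ := ih (m + 1) (by omega)
      obtain ⟨B, hB, h0⟩ := ih m (by omega)
      obtain ⟨H, hH, h2⟩ := abs_hermiteValue_le (m + 2)
      refine ⟨(m + 2) * (A + (m + 1) * B) + (m + 1) * (m + 2) * H, by positivity,
        fun N hN hm x => ?_⟩
      have hN0 : (0 : ℝ) < N := by exact_mod_cast hN
      have hm' : (m : ℝ) + 2 ≤ N := by exact_mod_cast hm
      set δ : ℝ := 1 - (m + 1) / N with hδ
      -- `N ≥ m + 2` gives `δ ≥ 1 / (m + 2)`, a bound independent of `N`.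
      have hδ1 : 1 ≤ (m + 2) * δ := by
        rw [hδ, mul_sub, mul_one, ← mul_div_assoc, le_sub_iff_add_le, ← le_sub_iff_add_le',
          div_le_iff₀ hN0]
        nlinarith [(Nat.cast_nonneg m : (0 : ℝ) ≤ m)]
      have hδ0 : 0 < δ := by
        by_contra! h
        nlinarith [(Nat.cast_nonneg m : (0 : ℝ) ≤ m)]
      have hinv : δ⁻¹ ≤ m + 2 := by
        rw [inv_le_iff_one_le_mul₀ hδ0]; exact hδ1
      have e1 : Real.exp (((m + 2 : ℕ) : ℝ) * |x|)
          = Real.exp |x| * Real.exp (((m + 1 : ℕ) : ℝ) * |x|) := by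
        rw [← Real.exp_add]; push_cast; ring_nf
      have e2 : Real.exp ((m : ℝ) * |x|) ≤ Real.exp (((m + 2 : ℕ) : ℝ) * |x|) := by
        gcongr; omega
      have e3 : krawtchouk N x (m + 2) - hermiteValue (m + 2) x
          = δ⁻¹ * (x * (krawtchouk N x (m + 1) - hermiteValue (m + 1) x)
            - (m + 1) * (krawtchouk N x m - hermiteValue m x)
            + (m + 1) / N * hermiteValue (m + 2) x) := by
        have e4 : krawtchouk N x (m + 2)
          = (x * krawtchouk N x (m + 1) - (m + 1) * krawtchouk N x m) / δ := rfl
        rw [e4, show ((m : ℝ) + 1) / N = 1 - δ by rw [hδ]; ring]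
        field_simp
        rw [hermiteValue_add_two]
        ring
      set E := Real.exp (((m + 2 : ℕ) : ℝ) * |x|)
      have b1 : |x * (krawtchouk N x (m + 1) - hermiteValue (m + 1) x)| ≤ A / N * E := by
        rw [abs_mul, e1]
        calc _ ≤ Real.exp |x| * (A / N * Real.exp (((m + 1 : ℕ) : ℝ) * |x|)) := by
              gcongr
              · exact abs_le_exp_abs x
              · exact h1 N hN (by omega) x
          _ = _ := by ring
      have b2 : |((m : ℝ) + 1) * (krawtchouk N x m - hermiteValue m x)|
          ≤ (m + 1) * (B / N * E) := by
        rw [abs_mul, abs_of_nonneg (by positivity : (0 : ℝ) ≤ m + 1)]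
        gcongr
        exact (h0 N hN (by omega) x).trans (by gcongr)
      have b3 : |((m : ℝ) + 1) / N * hermiteValue (m + 2) x| ≤ (m + 1) / N * (H * E) := by
        rw [abs_mul, abs_of_nonneg (by positivity : (0 : ℝ) ≤ ((m : ℝ) + 1) / N)]
        gcongr
        exact h2 x
      rw [e3, abs_mul, abs_of_pos (inv_pos.mpr hδ0)]
      calc _ ≤ ((m : ℝ) + 2) * (A / N * E + (m + 1) * (B / N * E) + (m + 1) / N * (H * E)) := by
            gcongr
            exact (abs_add_le _ _).trans
              (add_le_add ((norm_sub_le (_ : ℝ) _).trans (add_le_add b1 b2)) b3)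
        _ = _ := by ring

open Polynomial in
-- Substitute `2 X = (1 + X) - (1 - X)`. Comparing coefficients of `X ^ k` yields the Krawtchouk
-- recurrence in `m` with `m + t` fixed.
theorem X_mul_derivative_one_sub_X_pow_mul (m t : ℕ) :
    2 * X * derivative ((1 - X : ℝ[X]) ^ (m + 1) * (1 + X) ^ (t + 1))
      = ((m + t + 2 : ℕ) : ℝ[X]) * ((1 - X) ^ (m + 1) * (1 + X) ^ (t + 1))
        - ((m + 1 : ℕ) : ℝ[X]) * ((1 - X) ^ m * (1 + X) ^ (t + 2))
        - ((t + 1 : ℕ) : ℝ[X]) * ((1 - X) ^ (m + 2) * (1 + X) ^ t) := by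
  simp only [derivative_mul, derivative_pow, derivative_sub, derivative_add, derivative_X,
    derivative_one, Nat.add_sub_cancel]
  simp only [map_natCast]
  push_cast
  ring

open Polynomial in
theorem X_mul_derivative_one_add_X_pow (t : ℕ) :
    2 * X * derivative ((1 + X : ℝ[X]) ^ (t + 1))
      = ((t + 1 : ℕ) : ℝ[X]) * (1 + X) ^ (t + 1)
        - ((t + 1 : ℕ) : ℝ[X]) * ((1 - X) * (1 + X) ^ t) := by
  simp only [derivative_pow, derivative_add, derivative_X, derivative_one, Nat.add_sub_cancel]
  simp only [map_natCast]
  push_cast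
  ring

open Polynomial in
theorem coeff_X_mul_derivative (p : ℝ[X]) (k : ℕ) :
    (2 * X * derivative p).coeff k = 2 * k * p.coeff k := by
  rw [mul_assoc, ← C_ofNat, coeff_C_mul]
  cases k with
  | zero => simp
  | succ k => rw [coeff_X_mul, coeff_derivative]; push_cast; ring

open Polynomial in
/-- The coefficients of `(1 - X) ^ m * (1 + X) ^ t` are Krawtchouk polynomials. -/
theorem coeff_one_sub_X_pow_mul_one_add_X_pow (m t k : ℕ) (hN : 1 ≤ m + t) :
    Real.sqrt ((m + t : ℕ) : ℝ) ^ m * ((1 - X : ℝ[X]) ^ m * (1 + X) ^ t).coeff k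
      = (m + t).choose k * krawtchouk (m + t : ℕ)
        ((((m + t : ℕ) : ℝ) - 2 * k) / Real.sqrt ((m + t : ℕ) : ℝ)) m := by
  induction m using Nat.strong_induction_on generalizing t with
  | _ m ih =>
    match m with
    | 0 => simp [krawtchouk, coeff_one_add_X_pow]
    | 1 =>
      have h := congrArg (fun p : ℝ[X] => p.coeff k) (X_mul_derivative_one_add_X_pow t)
      simp only [coeff_X_mul_derivative, coeff_sub, coeff_natCast_mul] at h
      rw [add_comm 1 t, pow_one, pow_one]
      rw [coeff_one_add_X_pow] at h
      have hq : 0 < Real.sqrt ((t + 1 : ℕ) : ℝ) := by positivity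
      have hqq : Real.sqrt ((t + 1 : ℕ) : ℝ) * Real.sqrt ((t + 1 : ℕ) : ℝ) = (t + 1 : ℕ) :=
        Real.mul_self_sqrt (by positivity)
      simp only [krawtchouk]
      rw [← mul_div_assoc, eq_div_iff hq.ne', mul_right_comm, hqq]
      linarith
    | m + 2 =>
      have h := congrArg (fun p : ℝ[X] => p.coeff k) (X_mul_derivative_one_sub_X_pow_mul m t)
      simp only [coeff_X_mul_derivative, coeff_sub, coeff_natCast_mul] at h
      have i1 := ih (m + 1) (by omega) (t + 1) (by omega)
      have i0 := ih m (by omega) (t + 2) (by omega)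
      rw [show m + 1 + (t + 1) = m + 2 + t by ring] at i1
      rw [show m + (t + 2) = m + 2 + t by ring] at i0
      rw [show m + t + 2 = m + 2 + t by ring] at h
      set N := m + 2 + t with hNdef
      have hN0 : (0 : ℝ) < N := by positivity
      set q := Real.sqrt (N : ℝ)
      have hq : 0 < q := Real.sqrt_pos.mpr hN0
      have hqq : q ^ 2 = N := Real.sq_sqrt hN0.le
      have hδ : 1 - ((m : ℝ) + 1) / N = (t + 1) / N := by
        rw [eq_div_iff hN0.ne', sub_mul, div_mul_cancel₀ _ hN0.ne', hNdef]
        push_cast; ring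
      simp only [krawtchouk]
      rw [hδ]
      set x := ((N : ℝ) - 2 * k) / q with hx
      have hxq : x * q = N - 2 * k := by rw [hx, div_mul_cancel₀ _ hq.ne']
      set K1 := krawtchouk N x (m + 1)
      set K0 := krawtchouk N x m
      set a2 := ((1 - X : ℝ[X]) ^ (m + 2) * (1 + X) ^ t).coeff k
      set a1 := ((1 - X : ℝ[X]) ^ (m + 1) * (1 + X) ^ (t + 1)).coeff k
      set a0 := ((1 - X : ℝ[X]) ^ m * (1 + X) ^ (t + 2)).coeff k
      push_cast at h
      rw [div_div_eq_mul_div, ← mul_div_assoc, eq_div_iff (by positivity)]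
      have h' : ((t : ℝ) + 1) * a2 = x * q * a1 - (m + 1) * a0 := by
        rw [hxq]; linarith
      have s1 : q ^ (m + 2) * a2 * (t + 1) = q ^ 2 * (x * (q ^ (m + 1) * a1)
          - (m + 1) * (q ^ m * a0)) := by
        rw [mul_assoc, mul_comm a2, h']
        ring
      rw [s1, i1, i0, hqq]
      ring

/-! ### The coefficient norm of `(1 - X) ^ m (1 + X) ^ t` -/

/-- The sum of the absolute values of the coefficients of a real polynomial. -/
noncomputable def coeffL1 (p : Polynomial ℝ) : ℝ := p.sum fun _ a => |a|

theorem coeffL1_eq_sum_range {p : Polynomial ℝ} {n : ℕ} (h : p.natDegree < n) :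
    coeffL1 p = ∑ k ∈ Finset.range n, |p.coeff k| :=
  p.sum_over_range' (fun _ => abs_zero) n h

theorem coeffL1_nonneg (p : Polynomial ℝ) : 0 ≤ coeffL1 p :=
  Finset.sum_nonneg fun _ _ => abs_nonneg _

theorem sum_range_abs_coeff_le_coeffL1 (p : Polynomial ℝ) (n : ℕ) :
    ∑ k ∈ Finset.range n, |p.coeff k| ≤ coeffL1 p := by
  rw [coeffL1_eq_sum_range (lt_add_of_lt_of_nonneg (Nat.lt_succ_self _) (Nat.zero_le n))]
  exact Finset.sum_le_sum_of_subset_of_nonneg (by intro k; simp; omega) fun _ _ _ => abs_nonneg _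

theorem walk_eq_sum_range (n : ℕ) (f : ℝ → ℝ) :
    walk n f = ∑ k ∈ Finset.range (n + 1), (n.choose k : ℝ) * f ((n : ℝ) - 2 * k) / 2 ^ n := by
  unfold walk
  rw [Finset.Nat.sum_antidiagonal_eq_sum_range_succ_mk, Finset.sum_div]
  refine Finset.sum_congr rfl fun k hk => ?_
  rw [Finset.mem_range] at hk
  simp only
  rw [Nat.cast_sub (by omega)]
  congr 3
  ring

theorem abs_krawtchouk_le (m : ℕ) :
    ∃ C, 0 ≤ C ∧ ∀ N : ℕ, 1 ≤ N → m ≤ N → ∀ x,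
      |krawtchouk N x m| ≤ C * Real.exp (m * |x|) := by
  obtain ⟨A, hA, h1⟩ := abs_hermiteValue_le m
  obtain ⟨B, hB, h2⟩ := abs_krawtchouk_sub_hermiteValue_le m
  refine ⟨B + A, by positivity, fun N hN hm x => ?_⟩
  have h3 : B / N ≤ B := div_le_self hB (by exact_mod_cast hN)
  calc |krawtchouk N x m|
      = |(krawtchouk N x m - hermiteValue m x) + hermiteValue m x| := by rw [sub_add_cancel]
    _ ≤ B * Real.exp (m * |x|) + A * Real.exp (m * |x|) :=
        (abs_add_le _ _).trans (add_le_add ((h2 N hN hm x).trans (by gcongr)) (h1 x))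
    _ = _ := by ring

theorem walk_exp_abs_div_sqrt_le (N : ℕ) (t : ℝ) :
    walk N (fun s => Real.exp (t * |s / Real.sqrt N|)) ≤ 2 * Real.exp (t ^ 2 / 2) := by
  have e : (fun s : ℝ => Real.exp (t * |s / Real.sqrt N|))
      = fun s => Real.exp (t / Real.sqrt N * |s|) := by
    ext s
    rw [abs_div, abs_of_nonneg (Real.sqrt_nonneg _)]
    ring_nf
  rw [e]
  refine (walk_exp_abs_le _ _).trans ?_
  gcongr
  rw [div_pow, Real.sq_sqrt (Nat.cast_nonneg N)]
  rcases Nat.eq_zero_or_pos N with h | h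
  · simp only [h, Nat.cast_zero, zero_mul]; positivity
  · rw [mul_div_cancel₀]
    positivity

open Polynomial in
theorem abs_coeff_one_sub_X_pow_mul_one_add_X_pow (m t k : ℕ) (hN : 1 ≤ m + t) :
    |((1 - X : ℝ[X]) ^ m * (1 + X) ^ t).coeff k|
      = 2 ^ (m + t) / Real.sqrt ((m + t : ℕ) : ℝ) ^ m *
        ((m + t).choose k * |krawtchouk (m + t : ℕ)
          ((((m + t : ℕ) : ℝ) - 2 * k) / Real.sqrt ((m + t : ℕ) : ℝ)) m| / 2 ^ (m + t)) := by
  have hq : 0 < Real.sqrt ((m + t : ℕ) : ℝ) := Real.sqrt_pos.mpr (by exact_mod_cast hN)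
  have h := congrArg abs (coeff_one_sub_X_pow_mul_one_add_X_pow m t k hN)
  rw [abs_mul, abs_mul, abs_of_pos (pow_pos hq m), Nat.abs_cast] at h
  rw [← h]
  field_simp

open Polynomial in
theorem natDegree_one_sub_X_pow_mul_one_add_X_pow_le (m t : ℕ) :
    ((1 - X : ℝ[X]) ^ m * (1 + X) ^ t).natDegree ≤ m + t := by
  have h1 : (1 - X : ℝ[X]).natDegree ≤ 1 := by compute_degree
  have h2 : (1 + X : ℝ[X]).natDegree ≤ 1 := by compute_degree
  refine natDegree_mul_le.trans (add_le_add ?_ ?_)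
  · simpa using natDegree_pow_le_of_le m h1
  · simpa using natDegree_pow_le_of_le t h2

open Polynomial in
theorem coeffL1_one_sub_X_pow_mul_one_add_X_pow (m t : ℕ) (hN : 1 ≤ m + t) :
    coeffL1 ((1 - X) ^ m * (1 + X) ^ t)
      = 2 ^ (m + t) / Real.sqrt ((m + t : ℕ) : ℝ) ^ m *
        walk (m + t) (fun s =>
          |krawtchouk (m + t : ℕ) (s / Real.sqrt ((m + t : ℕ) : ℝ)) m|) := by
  rw [coeffL1_eq_sum_range (Nat.lt_succ_of_le (natDegree_one_sub_X_pow_mul_one_add_X_pow_le m t)),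
    walk_eq_sum_range, Finset.mul_sum]
  exact Finset.sum_congr rfl fun k _ => abs_coeff_one_sub_X_pow_mul_one_add_X_pow m t k hN

open Polynomial in
-- Each factor `1 - X` gains `(m + t) ^ (-1/2)`: the norm is a walk expectation of a Krawtchouk
-- polynomial, which is bounded uniformly in `t`.
theorem exists_coeffL1_one_sub_X_pow_le (m : ℕ) :
    ∃ C, 0 ≤ C ∧ ∀ t : ℕ, 1 ≤ m + t → coeffL1 ((1 - X) ^ m * (1 + X) ^ t)
      ≤ C * 2 ^ t / Real.sqrt ((m + t : ℕ) : ℝ) ^ m := by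
  obtain ⟨A, hA, h⟩ := abs_krawtchouk_le m
  refine ⟨2 ^ m * (A * (2 * Real.exp ((m : ℝ) ^ 2 / 2))), by positivity, fun t ht => ?_⟩
  rw [coeffL1_one_sub_X_pow_mul_one_add_X_pow m t ht]
  calc _ ≤ 2 ^ (m + t) / Real.sqrt ((m + t : ℕ) : ℝ) ^ m *
        (A * (2 * Real.exp ((m : ℝ) ^ 2 / 2))) := by
        gcongr
        refine (walk_mono _ fun s => h (m + t) ht (Nat.le_add_right _ _) _).trans ?_
        rw [walk_const_mul]
        gcongr
        exact walk_exp_abs_div_sqrt_le _ _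
    _ = _ := by rw [pow_add]; ring

open Polynomial in
theorem coeff_one_sub_X_pow_mul_one_add_X_pow_eq_diffChoose (m L k : ℕ) :
    ((1 - X : ℝ[X]) ^ m * (1 + X) ^ L).coeff k = diffChoose m L k := by
  have h : (1 - X : ℝ[X]) ^ m
      = ∑ l ∈ Finset.range (m + 1), C ((m.choose l : ℝ) * (-1) ^ l) * X ^ l := by
    rw [sub_eq_neg_add, add_pow]
    refine Finset.sum_congr rfl fun l _ => ?_
    simp [neg_pow (X : ℝ[X])]
    ring
  rw [h, Finset.sum_mul, finsetSum_coeff, diffChoose]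
  refine Finset.sum_congr rfl fun l _ => ?_
  rw [mul_assoc, coeff_C_mul, coeff_X_pow_mul']
  simp only [coeff_one_add_X_pow]

theorem exists_expLipschitz_aeval (p : Polynomial ℤ) :
    ∃ K c, 0 ≤ K ∧ 0 ≤ c ∧ ExpLipschitz K c fun x => |Polynomial.aeval x p| := by
  have growth : ∀ p : Polynomial ℤ, ∃ K, 0 ≤ K ∧
      ∀ x : ℝ, |Polynomial.aeval x p| ≤ K * Real.exp (1 * |x|) := by
    intro p
    induction p using Polynomial.induction_on' with
    | add p q hp hq =>
      obtain ⟨A, hA, h1⟩ := hp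
      obtain ⟨B, hB, h2⟩ := hq
      refine ⟨A + B, by positivity, fun x => ?_⟩
      rw [map_add, add_mul]
      exact (abs_add_le _ _).trans (add_le_add (h1 x) (h2 x))
    | monomial n a =>
      refine ⟨|(a : ℝ)| * n.factorial, by positivity, fun x => ?_⟩
      have h := Real.pow_div_factorial_le_exp |x| (abs_nonneg x) n
      rw [div_le_iff₀ (by positivity)] at h
      rw [Polynomial.aeval_monomial, abs_mul, abs_pow, one_mul, mul_assoc, eq_intCast,
        mul_comm (n.factorial : ℝ)]
      gcongr
  obtain ⟨K, hK, h⟩ := growth (Polynomial.derivative p)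
  have hd := expLipschitz_of_hasDerivAt hK zero_le_one
    (fun x => Polynomial.hasDerivAt_aeval p x) h
  exact ⟨K, 1, hK, zero_le_one, fun x y => (abs_abs_sub_abs_le_abs_sub _ _).trans (hd x y)⟩

/-- With `r = √L / √(m + L)`, Bernoulli's inequality gives `1 - r ^ m ≤ m (1 - r)`, and `1 - r ≤ 1 -
r² = m / (m + L) ≤ m / √L`. -/
theorem inv_sqrt_pow_sub_le (m L : ℕ) (hL : 1 ≤ L) :
    |1 / Real.sqrt ((m + L : ℕ) : ℝ) ^ m - 1 / Real.sqrt L ^ m|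
      ≤ (m : ℝ) ^ 2 / Real.sqrt L ^ (m + 1) := by
  have hL0 : (1 : ℝ) ≤ L := by exact_mod_cast hL
  set a := Real.sqrt (L : ℝ)
  set b := Real.sqrt ((m + L : ℕ) : ℝ)
  have ha1 : 1 ≤ a := Real.one_le_sqrt.mpr hL0
  have ha2 : a ^ 2 = L := Real.sq_sqrt (by positivity)
  have hb2 : b ^ 2 = m + L := by
    have : b ^ 2 = ((m + L : ℕ) : ℝ) := Real.sq_sqrt (by positivity)
    rw [this]; push_cast; ring
  have hab : a ≤ b := Real.sqrt_le_sqrt (by push_cast; linarith [(Nat.cast_nonneg m : (0:ℝ) ≤ m)])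
  have ha0 : 0 < a := by linarith
  have hb0 : 0 < b := by linarith
  have hr1 : a / b ≤ 1 := (div_le_one hb0).mpr hab
  have hr0 : 0 ≤ a / b := by positivity
  have hbern := one_add_mul_le_pow (by linarith : (-2 : ℝ) ≤ a / b - 1) m
  rw [add_sub_cancel] at hbern
  have e1 : 1 / b ^ m = (a / b) ^ m / a ^ m := by
    rw [div_pow]; field_simp
  have hle : (a / b) ^ m ≤ 1 := pow_le_one₀ hr0 hr1
  have h2 : 1 - a / b ≤ m / a := by
    have h3 : (a / b) ^ 2 ≤ a / b := by nlinarith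
    have h4 : 1 - (a / b) ^ 2 = m / b ^ 2 := by
      rw [div_pow]; field_simp; linarith
    have h5 : (m : ℝ) / b ^ 2 ≤ m / a := by
      gcongr
      nlinarith
    linarith
  rw [e1, ← sub_div, abs_div, abs_of_pos (pow_pos ha0 m), abs_sub_comm,
    abs_of_nonneg (by linarith), div_le_div_iff₀ (by positivity) (by positivity), pow_succ,
    ← mul_assoc, mul_right_comm]
  gcongr
  have h6 : 1 - (a / b) ^ m ≤ m * (m / a) := by
    nlinarith [(Nat.cast_nonneg m : (0:ℝ) ≤ m)]
  calc (1 - (a / b) ^ m) * a ≤ m * (m / a) * a := by gcongr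
    _ = (m : ℝ) ^ 2 := by field_simp

/-! ### Asymptotics of the differences of binomial coefficients -/

/-- The asymptotic size of the `m`-th differences of the binomial coefficients. -/
theorem exists_sum_abs_diffChoose_sub_le (m : ℕ) :
    ∃ C, 0 ≤ C ∧ ∀ L : ℕ, 1 ≤ L →
      |∑ k ∈ Finset.range (L + 1), (2 ^ L)⁻¹ * |diffChoose m L k|
          - hermiteConst m / Real.sqrt L ^ m| ≤ C / Real.sqrt L ^ (m + 1) := by
  obtain ⟨K, c, hK, hc, hlip⟩ := exists_expLipschitz_aeval (Polynomial.hermite m)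
  obtain ⟨C1, h1⟩ := exists_walk_sub_gauss_le hK hc hlip
  obtain ⟨C2, hC2, h2⟩ := abs_krawtchouk_sub_hermiteValue_le m
  obtain ⟨C3, hC3, h3⟩ := abs_krawtchouk_le m
  set μ := (∫ t : ℝ, |Polynomial.aeval t (Polynomial.hermite m)| * Real.exp (-(t ^ 2) / 2)) /
    Real.sqrt (2 * Real.pi) with hμ
  set C4 := C2 * (2 * Real.exp ((m : ℝ) ^ 2 / 2))
  set C5 := C3 * Real.exp (2 * m) * (2 * Real.exp ((m + 1 : ℝ) ^ 2 / 2))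
  have hC1 : 0 ≤ C1 := by simpa using (abs_nonneg _).trans (h1 0)
  have hμ0 : 0 ≤ μ := by
    refine div_nonneg (MeasureTheory.integral_nonneg fun t => ?_) (Real.sqrt_nonneg _)
    positivity
  have hherm : hermiteConst m = 2 ^ m * μ := by
    rw [hermiteConst, hμ]; ring
  refine ⟨2 ^ m * (C1 + C4 + C5) + 2 ^ m * μ * m ^ 2, by positivity, fun L hL => ?_⟩
  have hN : 1 ≤ m + L := by omega
  obtain ⟨n, hn⟩ : ∃ n, m + L = n + 1 := ⟨m + L - 1, by omega⟩
  have hinv := inv_sqrt_pow_sub_le m L hL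
  have hsum : ∑ k ∈ Finset.range (L + 1), (2 ^ L)⁻¹ * |diffChoose m L k|
      = 2 ^ m / Real.sqrt ((m + L : ℕ) : ℝ) ^ m *
        ∑ k ∈ Finset.range (L + 1), ((m + L).choose k * |krawtchouk (m + L : ℕ)
          ((((m + L : ℕ) : ℝ) - 2 * k) / Real.sqrt ((m + L : ℕ) : ℝ)) m| / 2 ^ (m + L)) := by
    rw [Finset.mul_sum]
    refine Finset.sum_congr rfl fun k _ => ?_
    rw [← coeff_one_sub_X_pow_mul_one_add_X_pow_eq_diffChoose,
      abs_coeff_one_sub_X_pow_mul_one_add_X_pow m L k hN, pow_add]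
    field_simp
  have hw1 := h1 n
  rw [← Nat.cast_add_one, ← hn] at hw1
  set N := m + L with hNdef
  have hN1 : (1 : ℝ) ≤ N := by exact_mod_cast hN
  have hmL : (N : ℝ) = m + L := by rw [hNdef]; push_cast; ring
  set b := Real.sqrt (N : ℝ) with hb
  have hb1 : 1 ≤ b := Real.one_le_sqrt.mpr hN1
  have hb2 : b ^ 2 = N := Real.sq_sqrt (by positivity)
  have hb0 : 0 < b := by linarith
  set T := ∑ k ∈ Finset.range (L + 1), (N.choose k * |krawtchouk N
          (((N : ℝ) - 2 * k) / b) m| / 2 ^ N)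
  have hw2 : |walk N (fun s => |krawtchouk N (s / b) m|)
      - walk N (fun s => |Polynomial.aeval (s / b) (Polynomial.hermite m)|)| ≤ C4 / b := by
    rw [← walk_sub]
    refine (abs_walk_le _ _).trans ((walk_mono _ (g := fun s =>
      C2 / N * Real.exp (m * |s / b|)) fun s => ?_).trans ?_)
    · exact (abs_abs_sub_abs_le_abs_sub _ _).trans (h2 N hN (by omega) _)
    · rw [walk_const_mul]
      calc _ ≤ C2 / b * (2 * Real.exp ((m : ℝ) ^ 2 / 2)) := by
            gcongr
            · exact walk_nonneg _ fun _ => (Real.exp_pos _).le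
            · nlinarith
            · exact walk_exp_abs_div_sqrt_le _ _
        _ = _ := by simp only [C4]; ring
  -- The sum stops at `k = L`, whereas `(1 - X) ^ m (1 + X) ^ L` has degree `L + m`. The `m` missing
  -- terms lie at distance at least `b - 2 m` from the centre in normalised units, where `b ≤ exp (2
  -- m) exp |x|` gains the factor `1 / b`.
  have htail : |T - walk N (fun s => |krawtchouk N (s / b) m|)| ≤ C5 / b := by
    rw [walk_eq_sum_range, hNdef, show m + L + 1 = L + 1 + m by ring,
      Finset.sum_range_add _ (L + 1) m, sub_add_cancel_left, abs_neg, ← hNdef,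
      abs_of_nonneg (Finset.sum_nonneg fun _ _ => by positivity)]
    have hpt : ∀ j ∈ Finset.range m, (N.choose (L + 1 + j) : ℝ) *
        |krawtchouk N (((N : ℝ) - 2 * (L + 1 + j : ℕ)) / b) m| / 2 ^ N
        ≤ (N.choose (L + 1 + j) : ℝ) * (C3 * Real.exp (2 * m) / b *
          Real.exp ((m + 1) * |((N : ℝ) - 2 * (L + 1 + j : ℕ)) / b|)) / 2 ^ N := by
      intro j _
      set x := ((N : ℝ) - 2 * (L + 1 + j : ℕ)) / b with hx
      have hxb : b - 2 * m ≤ |x| := by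
        rw [hx, abs_div, abs_of_pos hb0, le_div_iff₀ hb0]
        refine le_trans ?_ (neg_le_abs _)
        push_cast
        nlinarith [(Nat.cast_nonneg m : (0:ℝ) ≤ m), (Nat.cast_nonneg j : (0:ℝ) ≤ j)]
      have h5 : b ≤ Real.exp (2 * m) * Real.exp |x| := by
        rw [← Real.exp_add]
        calc b ≤ Real.exp b := by linarith [Real.add_one_le_exp b]
          _ ≤ _ := by gcongr; linarith
      gcongr
      refine (h3 N hN (by omega) x).trans ?_
      rw [add_mul, one_mul, Real.exp_add, div_mul_eq_mul_div, le_div_iff₀ hb0]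
      calc C3 * Real.exp (m * |x|) * b
          ≤ C3 * Real.exp (m * |x|) * (Real.exp (2 * m) * Real.exp |x|) := by gcongr
        _ = _ := by ring
    refine (Finset.sum_le_sum hpt).trans ?_
    have h6 : walk N (fun s => C3 * Real.exp (2 * m) / b * Real.exp ((m + 1) * |s / b|))
        ≤ C5 / b := by
      rw [walk_const_mul]
      calc _ ≤ C3 * Real.exp (2 * m) / b * (2 * Real.exp ((m + 1 : ℝ) ^ 2 / 2)) := by
            gcongr
            exact walk_exp_abs_div_sqrt_le _ _
        _ = _ := by simp only [C5]; ring
    refine le_trans ?_ h6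
    rw [walk_eq_sum_range, show N + 1 = L + 1 + m by omega, Finset.sum_range_add _ (L + 1) m]
    refine le_add_of_nonneg_left (Finset.sum_nonneg fun _ _ => ?_)
    positivity
  have hT : |T - μ| ≤ (C1 + C4 + C5) / b := by
    rw [add_div, add_div]
    rw [abs_le] at *
    constructor <;> linarith
  set a := Real.sqrt (L : ℝ)
  have ha1 : 1 ≤ a := Real.one_le_sqrt.mpr (by exact_mod_cast hL)
  have hab : a ≤ b := Real.sqrt_le_sqrt (by rw [hmL]; linarith [(Nat.cast_nonneg m : (0:ℝ) ≤ m)])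
  have e : 2 ^ m / b ^ m * T - 2 ^ m * μ / a ^ m
      = 2 ^ m / b ^ m * (T - μ) + 2 ^ m * μ * (1 / b ^ m - 1 / a ^ m) := by ring
  rw [hsum, hherm, e]
  calc _ ≤ 2 ^ m / b ^ m * ((C1 + C4 + C5) / b) + 2 ^ m * μ * ((m : ℝ) ^ 2 / a ^ (m + 1)) := by
        refine (abs_add_le _ _).trans (add_le_add ?_ ?_)
        · rw [abs_mul, abs_of_nonneg (by positivity : (0 : ℝ) ≤ 2 ^ m / b ^ m)]
          gcongr
        · rw [abs_mul, abs_of_nonneg (by positivity : (0 : ℝ) ≤ 2 ^ m * μ)]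
          gcongr
    _ = 2 ^ m * (C1 + C4 + C5) / b ^ (m + 1) + 2 ^ m * μ * m ^ 2 / a ^ (m + 1) := by
        rw [pow_succ b]; field_simp
    _ ≤ 2 ^ m * (C1 + C4 + C5) / a ^ (m + 1) + 2 ^ m * μ * m ^ 2 / a ^ (m + 1) := by
        gcongr
    _ = _ := by ring

/-! ### Algebra of the coefficient norm -/

section

open Polynomial

theorem coeffL1_add_le (p q : ℝ[X]) : coeffL1 (p + q) ≤ coeffL1 p + coeffL1 q := by
  set n := max p.natDegree q.natDegree + 1
  have hpq := natDegree_add_le p q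
  rw [coeffL1_eq_sum_range (n := n) (by omega), coeffL1_eq_sum_range (p := p) (n := n) (by omega),
    coeffL1_eq_sum_range (p := q) (n := n) (by omega), ← Finset.sum_add_distrib]
  exact Finset.sum_le_sum fun k _ => by rw [coeff_add]; exact abs_add_le _ _

theorem coeffL1_C_mul (a : ℝ) (p : ℝ[X]) : coeffL1 (C a * p) = |a| * coeffL1 p := by
  have h := natDegree_C_mul_le a p
  rw [coeffL1_eq_sum_range (n := p.natDegree + 1) (by omega),
    coeffL1_eq_sum_range (p := p) (n := p.natDegree + 1) (by omega), Finset.mul_sum]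
  exact Finset.sum_congr rfl fun k _ => by rw [coeff_C_mul, abs_mul]

theorem coeffL1_zero : coeffL1 0 = 0 := by simp [coeffL1]

theorem coeffL1_X_pow (e : ℕ) : coeffL1 (X ^ e) = 1 := by
  simp [coeffL1, X_pow_eq_monomial, sum_monomial_index]

theorem coeffL1_neg (p : ℝ[X]) : coeffL1 (-p) = coeffL1 p := by
  have := coeffL1_C_mul (-1) p
  simpa using this

theorem coeffL1_sub_le (p q : ℝ[X]) : coeffL1 (p - q) ≤ coeffL1 p + coeffL1 q := by
  rw [sub_eq_add_neg, ← coeffL1_neg q]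
  exact coeffL1_add_le _ _

theorem coeffL1_sum_le {ι : Type*} (s : Finset ι) (f : ι → ℝ[X]) :
    coeffL1 (∑ i ∈ s, f i) ≤ ∑ i ∈ s, coeffL1 (f i) := by
  classical
  induction s using Finset.induction_on with
  | empty => simp [coeffL1_zero]
  | insert i s hi ih =>
    rw [Finset.sum_insert hi, Finset.sum_insert hi]
    exact (coeffL1_add_le _ _).trans (by gcongr)

theorem coeffL1_X_pow_mul (e : ℕ) (p : ℝ[X]) : coeffL1 (X ^ e * p) = coeffL1 p := by
  have h : (X ^ e * p).natDegree ≤ e + p.natDegree := by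
    simpa using natDegree_mul_le (p := (X : ℝ[X]) ^ e) (q := p)
  rw [coeffL1_eq_sum_range (n := e + (p.natDegree + 1)) (by omega), Finset.sum_range_add,
    coeffL1_eq_sum_range (p := p) (n := p.natDegree + 1) (by omega)]
  have h0 : ∑ k ∈ Finset.range e, |(X ^ e * p).coeff k| = 0 :=
    Finset.sum_eq_zero fun k hk => by
      rw [coeff_X_pow_mul', if_neg (by rw [Finset.mem_range] at hk; omega), abs_zero]
  rw [h0, zero_add]
  exact Finset.sum_congr rfl fun k _ => by rw [add_comm e k, coeff_X_pow_mul]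

theorem coeffL1_mul_le (p q : ℝ[X]) : coeffL1 (p * q) ≤ coeffL1 p * coeffL1 q := by
  conv_lhs => rw [p.as_sum_support_C_mul_X_pow, Finset.sum_mul]
  refine (coeffL1_sum_le _ _).trans_eq ?_
  rw [coeffL1, Polynomial.sum, Finset.sum_mul]
  exact Finset.sum_congr rfl fun k _ => by rw [mul_assoc, coeffL1_C_mul, coeffL1_X_pow_mul]

theorem coeffL1_pow_le_one {p : ℝ[X]} (hp : coeffL1 p ≤ 1) (n : ℕ) : coeffL1 (p ^ n) ≤ 1 := by
  induction n with
  | zero => simpa using (coeffL1_X_pow 0).le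
  | succ n ih =>
    rw [pow_succ]
    exact (coeffL1_mul_le _ _).trans (mul_le_one₀ ih (coeffL1_nonneg _) hp)

theorem abs_eval_one_le_coeffL1 (p : ℝ[X]) : |p.eval 1| ≤ coeffL1 p := by
  rw [eval_eq_sum, coeffL1]
  simpa [Polynomial.sum] using Finset.abs_sum_le_sum_abs p.coeff p.support

/-- The coefficients of the quotient are tail sums of those of `p`, so each is at most `coeffL1 p`,
and at most `n` of them are nonzero. -/
theorem coeffL1_divByMonic_X_sub_C_one_le (p : ℝ[X]) {n : ℕ} (hp : p.natDegree ≤ n) :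
    coeffL1 (p /ₘ (X - C 1)) ≤ n * coeffL1 p := by
  have hdeg : (p /ₘ (X - C 1)).natDegree = p.natDegree - 1 := by
    rw [natDegree_divByMonic p (monic_X_sub_C 1), natDegree_X_sub_C]
  rcases Nat.eq_zero_or_pos p.natDegree with h0 | h0
  · have : p /ₘ (X - C 1) = 0 := by
      rw [divByMonic_eq_zero_iff (monic_X_sub_C 1), degree_X_sub_C]
      exact (degree_le_of_natDegree_le h0.le).trans_lt (by norm_num)
    rw [this, coeffL1_zero]
    exact mul_nonneg (Nat.cast_nonneg _) (coeffL1_nonneg _)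
  · rw [coeffL1_eq_sum_range (n := p.natDegree) (by omega)]
    have hk : ∀ k ∈ Finset.range p.natDegree, |(p /ₘ (X - C 1)).coeff k| ≤ coeffL1 p := by
      intro k _
      rw [coeff_divByMonic_X_sub_C, coeffL1_eq_sum_range (Nat.lt_succ_self _),
        Finset.range_eq_Ico, Nat.succ_eq_add_one, Finset.Ico_add_one_right_eq_Icc]
      refine (Finset.abs_sum_le_sum_abs _ _).trans ?_
      simp only [one_pow, one_mul]
      exact Finset.sum_le_sum_of_subset_of_nonneg
        (Finset.Icc_subset_Icc_left (Nat.zero_le _)) fun _ _ _ => abs_nonneg _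
    refine (Finset.sum_le_sum hk).trans ?_
    rw [Finset.sum_const, Finset.card_range, nsmul_eq_mul]
    gcongr
    exact coeffL1_nonneg _

/-! ### Taylor expansion at `1` by repeated division -/

/-- The probability generating function of a fair bit. -/
noncomputable def bitPoly : ℝ[X] := C (1 / 2) * (1 + X)

theorem eval_bitPoly (y : ℝ) : bitPoly.eval y = (1 + y) / 2 := by
  simp [bitPoly]; ring

theorem coeffL1_bitPoly_le : coeffL1 bitPoly ≤ 1 := by
  rw [bitPoly, coeffL1_C_mul]
  have h1 := coeffL1_X_pow 0
  have h2 := coeffL1_X_pow 1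
  have h := coeffL1_add_le 1 X
  rw [pow_zero] at h1
  rw [pow_one] at h2
  rw [abs_of_pos (by norm_num)]
  linarith

theorem natDegree_bitPoly_pow_le (d : ℕ) : (bitPoly ^ d).natDegree ≤ d := by
  have h : bitPoly.natDegree ≤ 1 := by unfold bitPoly; compute_degree
  simpa using natDegree_pow_le_of_le d h

/-- The polynomial `(f - f(1) B ^ d) / (X - 1)`, where `B = (1 + X) / 2`. -/
noncomputable def slopePoly (d : ℕ) (f : ℝ[X]) : ℝ[X] :=
  (f - C (f.eval 1) * bitPoly ^ d) /ₘ (X - C 1)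

theorem X_sub_one_mul_slopePoly (d : ℕ) (f : ℝ[X]) :
    (X - C 1) * slopePoly d f = f - C (f.eval 1) * bitPoly ^ d := by
  refine mul_divByMonic_eq_iff_isRoot.mpr ?_
  simp [eval_bitPoly]

theorem slopePoly_eq {d : ℕ} {f g : ℝ[X]}
    (h : (X - C 1) * g = f - C (f.eval 1) * bitPoly ^ d) : slopePoly d f = g :=
  mul_left_cancel₀ (X_sub_C_ne_zero (1 : ℝ)) ((X_sub_one_mul_slopePoly d f).trans h.symm)

/-- Since `B(1) = 1`, `f` and `f B ^ e` agree at `1`, and `B ^ e` factors out. In terms of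
quotients, `f / B ^ d` is unchanged when numerator and denominator are multiplied by `B ^ e`. -/
theorem slopePoly_mul_bitPoly_pow (d e : ℕ) (f : ℝ[X]) :
    slopePoly (d + e) (f * bitPoly ^ e) = slopePoly d f * bitPoly ^ e := by
  apply slopePoly_eq
  rw [← mul_assoc, X_sub_one_mul_slopePoly, eval_mul, eval_pow, eval_bitPoly]
  norm_num
  ring

theorem slopePoly_C_mul (d : ℕ) (a : ℝ) (f : ℝ[X]) :
    slopePoly d (C a * f) = C a * slopePoly d f := by
  apply slopePoly_eq
  rw [mul_left_comm, X_sub_one_mul_slopePoly, eval_C_mul, C_mul]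
  ring

theorem slopePoly_sum {ι : Type*} (s : Finset ι) (d : ℕ) (f : ι → ℝ[X]) :
    slopePoly d (∑ i ∈ s, f i) = ∑ i ∈ s, slopePoly d (f i) := by
  apply slopePoly_eq
  simp_rw [Finset.mul_sum, X_sub_one_mul_slopePoly, Finset.sum_sub_distrib, eval_finsetSum,
    ← Finset.sum_mul, map_sum]

theorem iterate_slopePoly_mul_bitPoly_pow (M d e : ℕ) (f : ℝ[X]) :
    (slopePoly (d + e))^[M] (f * bitPoly ^ e) = (slopePoly d)^[M] f * bitPoly ^ e := by
  induction M generalizing f with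
  | zero => rfl
  | succ M ih => rw [Function.iterate_succ_apply, slopePoly_mul_bitPoly_pow, ih]; rfl

theorem iterate_slopePoly_C_mul (M d : ℕ) (a : ℝ) (f : ℝ[X]) :
    (slopePoly d)^[M] (C a * f) = C a * (slopePoly d)^[M] f := by
  induction M generalizing f with
  | zero => rfl
  | succ M ih => rw [Function.iterate_succ_apply, slopePoly_C_mul, ih]; rfl

theorem iterate_slopePoly_sum {ι : Type*} (s : Finset ι) (M d : ℕ) (f : ι → ℝ[X]) :
    (slopePoly d)^[M] (∑ i ∈ s, f i) = ∑ i ∈ s, (slopePoly d)^[M] (f i) := by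
  induction M generalizing f with
  | zero => rfl
  | succ M ih => rw [Function.iterate_succ_apply, slopePoly_sum, ih]; rfl

theorem natDegree_sub_C_mul_bitPoly_pow_le {d n : ℕ} {f : ℝ[X]} (hd : d ≤ n)
    (hf : f.natDegree ≤ n) (a : ℝ) : (f - C a * bitPoly ^ d).natDegree ≤ n :=
  (natDegree_sub_le _ _).trans (max_le hf
    ((natDegree_C_mul_le _ _).trans ((natDegree_bitPoly_pow_le d).trans hd)))

theorem natDegree_iterate_slopePoly_le (M : ℕ) {d n : ℕ} {f : ℝ[X]} (hd : d ≤ n)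
    (hf : f.natDegree ≤ n) : ((slopePoly d)^[M] f).natDegree ≤ n := by
  induction M generalizing f with
  | zero => exact hf
  | succ M ih =>
    refine ih ?_
    rw [slopePoly, natDegree_divByMonic _ (monic_X_sub_C 1)]
    exact (Nat.sub_le _ _).trans (natDegree_sub_C_mul_bitPoly_pow_le hd hf _)

/-- Each iteration costs a factor `2` for subtracting `g(1) B ^ d`, as `|g(1)|` is at most the norm
of `g` and `B ^ d` has norm at most `1`, and a factor `n` for the division. -/
theorem coeffL1_iterate_slopePoly_le (M : ℕ) {d n : ℕ} {f : ℝ[X]} (hd : d ≤ n)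
    (hf : f.natDegree ≤ n) : coeffL1 ((slopePoly d)^[M] f) ≤ (2 * n) ^ M * coeffL1 f := by
  induction M with
  | zero => simp
  | succ M ih =>
    rw [Function.iterate_succ_apply']
    set g := (slopePoly d)^[M] f
    have hg : g.natDegree ≤ n := natDegree_iterate_slopePoly_le M hd hf
    have h1 : coeffL1 (g - C (g.eval 1) * bitPoly ^ d) ≤ 2 * coeffL1 g := by
      refine (coeffL1_sub_le _ _).trans ?_
      rw [coeffL1_C_mul, two_mul]
      gcongr
      exact (mul_le_of_le_one_right (abs_nonneg _) (coeffL1_pow_le_one coeffL1_bitPoly_le d)).trans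
        (abs_eval_one_le_coeffL1 g)
    calc coeffL1 (slopePoly d g) ≤ n * coeffL1 (g - C (g.eval 1) * bitPoly ^ d) := by
          exact coeffL1_divByMonic_X_sub_C_one_le _ (natDegree_sub_C_mul_bitPoly_pow_le hd hg _)
      _ ≤ n * (2 * ((2 * n) ^ M * coeffL1 f)) := by gcongr; linarith
      _ = _ := by ring

theorem eq_sum_add_iterate_slopePoly (M d : ℕ) (f : ℝ[X]) :
    f = ∑ r ∈ Finset.range M, C (((slopePoly d)^[r] f).eval 1) * ((X - C 1) ^ r * bitPoly ^ d)
      + (X - C 1) ^ M * (slopePoly d)^[M] f := by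
  induction M with
  | zero => simp
  | succ M ih =>
    rw [Finset.sum_range_succ, Function.iterate_succ_apply', pow_succ, mul_assoc (_ ^ M),
      X_sub_one_mul_slopePoly]
    conv_lhs => rw [ih]
    ring

theorem bitPoly_pow (d : ℕ) : bitPoly ^ d = C ((2 ^ d)⁻¹) * (1 + X) ^ d := by
  rw [bitPoly, mul_pow, ← C_pow, one_div, inv_pow]

theorem X_sub_one_pow_mul_bitPoly_pow (r d : ℕ) :
    (X - C 1) ^ r * bitPoly ^ d
      = C ((-1) ^ r * (2 ^ d)⁻¹) * ((1 - X) ^ r * (1 + X) ^ d) := by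
  have h : (X - C 1 : ℝ[X]) = C (-1) * (1 - X) := by simp
  rw [h, mul_pow, bitPoly_pow, C_mul, C_pow]
  ring

theorem coeff_X_sub_one_pow_mul_bitPoly_pow (r d k : ℕ) :
    ((X - C 1) ^ r * bitPoly ^ d).coeff k = (-1) ^ r * (2 ^ d)⁻¹ * diffChoose r d k := by
  rw [X_sub_one_pow_mul_bitPoly_pow, coeff_C_mul,
    coeff_one_sub_X_pow_mul_one_add_X_pow_eq_diffChoose]

theorem exists_coeffL1_X_sub_one_pow_le (m : ℕ) :
    ∃ C₀, 0 ≤ C₀ ∧ ∀ t : ℕ, 1 ≤ m + t → coeffL1 ((X - C 1) ^ m * bitPoly ^ t)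
      ≤ C₀ / Real.sqrt ((m + t : ℕ) : ℝ) ^ m := by
  obtain ⟨A, hA, h⟩ := exists_coeffL1_one_sub_X_pow_le m
  refine ⟨A, hA, fun t ht => ?_⟩
  rw [X_sub_one_pow_mul_bitPoly_pow, coeffL1_C_mul, abs_mul, abs_pow, abs_neg, abs_one, one_pow,
    one_mul, abs_of_pos (by positivity : (0 : ℝ) < (2 ^ t)⁻¹)]
  calc _ ≤ ((2 : ℝ) ^ t)⁻¹ * (A * 2 ^ t / Real.sqrt ((m + t : ℕ) : ℝ) ^ m) := by
        gcongr
        exact h t ht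
    _ = _ := by field_simp

/-! ### From laws to generating polynomials -/

theorem fairBit_apply (b : ℕ) : fairBit b = if b = 0 ∨ b = 1 then 2⁻¹ else 0 := by
  simp [fairBit, PMF.uniformOfFinset_apply]

theorem map_add_fairBit_apply (a k : ℕ) :
    (fairBit.map fun b => a + b) k = if k = a ∨ k = a + 1 then 2⁻¹ else 0 := by
  rw [PMF.map_apply, tsum_eq_sum (s := {0, 1})]
  · have h0 : fairBit 0 = 2⁻¹ := by simp [fairBit_apply]
    have h1 : fairBit 1 = 2⁻¹ := by simp [fairBit_apply]
    rw [Finset.sum_pair zero_ne_one, h0, h1]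
    split_ifs <;> first | omega | simp
  · intro b hb
    have h : fairBit b = 0 := by
      rw [fairBit_apply, if_neg (by simpa using hb)]
    rw [h, ite_self]

theorem indepSum_fairBit_toReal (p : PMF ℕ) (k : ℕ) :
    (indepSum p fairBit k).toReal
      = ((p k).toReal + if 1 ≤ k then (p (k - 1)).toReal else 0) / 2 := by
  rw [indepSum, PMF.bind_apply]
  simp only [map_add_fairBit_apply]
  cases k with
  | zero =>
    rw [tsum_eq_single 0]
    · simp [div_eq_mul_inv]
    · intro b hb
      rw [if_neg (by omega), mul_zero]
  | succ k =>
    rw [tsum_eq_sum (s := {k, k + 1})]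
    · rw [Finset.sum_pair (by omega), ENNReal.toReal_add]
      · simp [div_eq_mul_inv]; ring
      · exact ENNReal.mul_ne_top (PMF.apply_ne_top _ _) (by simp)
      · exact ENNReal.mul_ne_top (PMF.apply_ne_top _ _) (by simp)
    · intro b hb
      simp only [Finset.mem_insert, Finset.mem_singleton, not_or] at hb
      rw [if_neg (by omega), mul_zero]

namespace BinaryCoding

/-- The sum of `X ^ ones j` over `j < n`. -/
noncomputable def onesPoly (S : BinaryCoding) (n : ℕ) : ℝ[X] :=
  ∑ j ∈ Finset.range n, X ^ S.ones j

theorem prob_eq (S : BinaryCoding) {n : ℕ} (hn : 1 ≤ n) (k : ℕ) :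
    S.prob n k = (S.onesPoly n).coeff k / n := by
  have hn0 : n ≠ 0 := by omega
  rw [prob, law, dif_neg hn0, PMF.map_apply, tsum_eq_sum (s := Finset.range n)]
  · rw [ENNReal.toReal_sum]
    · rw [onesPoly, finsetSum_coeff, Finset.sum_div]
      refine Finset.sum_congr rfl fun j hj => ?_
      rw [coeff_X_pow, PMF.uniformOfFinset_apply_of_mem _ hj, Finset.card_range]
      split_ifs <;> simp
    · intro j hj
      rw [PMF.uniformOfFinset_apply_of_mem _ hj, Finset.card_range]
      split_ifs <;> simp [hn0]
  · intro j hj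
    rw [PMF.uniformOfFinset_apply_of_notMem _ hj, ite_self]

theorem pgf_eq (S : BinaryCoding) {n : ℕ} (hn : 1 ≤ n) (y : ℝ) :
    S.pgf n y = (S.onesPoly n).eval y / n := by
  have h0 : ∀ k, (S.onesPoly n).natDegree < k → S.law n k = 0 := by
    intro k hk
    have h := S.prob_eq hn k
    rw [coeff_eq_zero_of_natDegree_lt hk, zero_div, prob, ENNReal.toReal_eq_zero_iff] at h
    exact h.resolve_right (PMF.apply_ne_top _ _)
  have hae : ∀ᵐ z ∂(S.law n).toMeasure, z ∈ Finset.range ((S.onesPoly n).natDegree + 1) := by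
    rw [MeasureTheory.ae_iff, PMF.toMeasure_apply_eq_zero_iff _ (by measurability),
      Set.disjoint_left]
    intro z hz hz2
    rw [PMF.mem_support_iff] at hz
    exact hz (h0 z (by simpa using hz2))
  have hint : MeasureTheory.Integrable (fun z : ℕ => y ^ z) (S.law n).toMeasure := by
    refine MeasureTheory.Integrable.of_bound (by fun_prop)
      (∑ k ∈ Finset.range ((S.onesPoly n).natDegree + 1), ‖y ^ k‖) ?_
    filter_upwards [hae] with z hz
    exact Finset.single_le_sum (f := fun k => ‖y ^ k‖) (fun _ _ => norm_nonneg _) hz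
  rw [pgf, PMF.integral_eq_tsum _ _ hint,
    tsum_eq_sum (s := Finset.range ((S.onesPoly n).natDegree + 1)), eval_eq_sum_range,
    Finset.sum_div]
  · refine Finset.sum_congr rfl fun k _ => ?_
    have := S.prob_eq hn k
    rw [prob] at this
    rw [this, smul_eq_mul]
    ring
  · intro k hk
    rw [h0 k (by simpa using hk), ENNReal.toReal_zero, zero_smul]

variable {S : BinaryCoding}

theorem IsDoubling.onesPoly_one (hS : S.IsDoubling) : S.onesPoly 1 = 1 := by
  ext k
  have h := S.prob_eq le_rfl k
  rw [prob, hS.law_one, PMF.pure_apply, Nat.cast_one, div_one] at h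
  rw [← h, coeff_one]
  split_ifs <;> simp

theorem IsDoubling.onesPoly_two_mul (hS : S.IsDoubling) (n : ℕ) :
    S.onesPoly (2 * n) = (1 + X) * S.onesPoly n := by
  rcases Nat.eq_zero_or_pos n with rfl | hn
  · simp [onesPoly]
  ext k
  have h := S.prob_eq (n := 2 * n) (by omega) k
  rw [prob, hS.law_two_mul n hn, indepSum_fairBit_toReal] at h
  have h1 := S.prob_eq hn k
  have h2 := S.prob_eq hn (k - 1)
  rw [prob] at h1 h2
  have hn0 : (n : ℝ) ≠ 0 := by positivity
  rw [h1, h2] at h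
  rw [add_mul, one_mul, coeff_add, show (X : ℝ[X]) * S.onesPoly n = X ^ 1 * S.onesPoly n by simp,
    coeff_X_pow_mul']
  push_cast at h
  field_simp at h
  rw [← h]
  split_ifs
  · field_simp
  · simp

/-- Subtracting the doubling identity at `n` from that at `n + 1` gives `X ^ ones (2n) + X ^ ones
(2n+1) = X ^ ones n + X ^ (ones n + 1)`. The coefficients on the left are nonnegative, so nothing
cancels above degree `ones n + 1`. -/
theorem IsDoubling.ones_le (hS : S.IsDoubling) (n : ℕ) :
    S.ones (2 * n) ≤ S.ones n + 1 ∧ S.ones (2 * n + 1) ≤ S.ones n + 1 := by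
  have h1 := hS.onesPoly_two_mul (n + 1)
  have h0 := hS.onesPoly_two_mul n
  have h : (X : ℝ[X]) ^ S.ones (2 * n) + X ^ S.ones (2 * n + 1) = (1 + X) * X ^ S.ones n := by
    have e1 : S.onesPoly (2 * (n + 1))
        = S.onesPoly (2 * n) + X ^ S.ones (2 * n) + X ^ S.ones (2 * n + 1) := by
      simp only [onesPoly, show 2 * (n + 1) = 2 * n + 1 + 1 by ring, Finset.sum_range_succ]
    have e2 : S.onesPoly (n + 1) = S.onesPoly n + X ^ S.ones n := by
      simp only [onesPoly, Finset.sum_range_succ]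
    rw [e1, e2, h0] at h1
    linear_combination h1
  have hc : ∀ k, S.ones n + 1 < k → ((X : ℝ[X]) ^ S.ones (2 * n)).coeff k
      + ((X : ℝ[X]) ^ S.ones (2 * n + 1)).coeff k = 0 := by
    intro k hk
    rw [← coeff_add, h, add_mul, one_mul, ← pow_succ', coeff_add, coeff_X_pow, coeff_X_pow,
      if_neg (by omega), if_neg (by omega), add_zero]
  constructor
  · by_contra! hk
    have := hc _ hk
    simp only [coeff_X_pow] at this
    split_ifs at this <;> norm_num at this
  · by_contra! hk
    have := hc _ hk
    simp only [coeff_X_pow] at this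
    split_ifs at this <;> norm_num at this

theorem IsDoubling.ones_zero (hS : S.IsDoubling) : S.ones 0 = 0 := by
  have h := hS.onesPoly_one
  simp only [onesPoly, Finset.sum_range_one] at h
  simpa using congrArg natDegree h

theorem IsDoubling.ones_le_log (hS : S.IsDoubling) (j : ℕ) : S.ones j ≤ Nat.log 2 j + 1 := by
  induction j using Nat.strong_induction_on with
  | _ j ih =>
    rcases Nat.lt_or_ge j 2 with hj | hj
    · have h0 := hS.ones_zero
      have h1 := (hS.ones_le 0).2
      interval_cases j
      · omega
      · simp only [mul_zero, zero_add] at h1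
        omega
    · have h2 := ih (j / 2) (by omega)
      have h3 := Nat.log_of_one_lt_of_le one_lt_two hj
      have h4 := hS.ones_le (j / 2)
      rcases Nat.even_or_odd' j with ⟨k, rfl | rfl⟩
      · rw [show 2 * k / 2 = k by omega] at *
        omega
      · rw [show (2 * k + 1) / 2 = k by omega] at *
        omega

/-- The blocks of the binary expansion of `n`. -/
theorem IsDoubling.onesPoly_eq_sum (hS : S.IsDoubling) {n : ℕ} (hn : 1 ≤ n) :
    ∃ f : ℕ → ℝ[X], (∀ d, (f d).natDegree ≤ d + 1 ∧ coeffL1 (f d) ≤ 1) ∧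
      S.onesPoly n = ∑ d ∈ Finset.range (Nat.log 2 n + 1), f d * (1 + X) ^ (Nat.log 2 n - d) := by
  induction n using Nat.strong_induction_on with
  | _ n ih =>
    rcases Nat.lt_or_ge n 2 with h2 | h2
    · obtain rfl : n = 1 := by omega
      refine ⟨fun _ => 1, fun d => ⟨by simp, by simpa using (coeffL1_X_pow 0).le⟩, ?_⟩
      simp [hS.onesPoly_one]
    · obtain ⟨f, hf, hP⟩ := ih (n / 2) (by omega) (by omega)
      have hlog := Nat.log_of_one_lt_of_le one_lt_two h2
      set m := n / 2 with hm
      set l := Nat.log 2 m with hl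
      -- Appending a binary digit to `m` multiplies the old blocks by `1 + X` and adds a block at
      -- depth `l + 1`: zero for the digit `0`, and for the digit `1` the monomial of the last
      -- integer `2 m`, of degree at most `ones m + 1 ≤ l + 2`.
      have step : ∀ g : ℕ → ℝ[X], (∀ d ∈ Finset.range (l + 1), g d = f d) →
          (1 + X) * S.onesPoly m + g (l + 1)
            = ∑ d ∈ Finset.range (l + 1 + 1), g d * (1 + X) ^ (l + 1 - d) := by
        intro g hg
        rw [Finset.sum_range_succ, Nat.sub_self, pow_zero, mul_one, hP, Finset.mul_sum]
        congr 1
        refine Finset.sum_congr rfl fun d hd => ?_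
        rw [hg d hd, Nat.succ_sub (by rw [Finset.mem_range] at hd; omega), pow_succ]
        ring
      rw [hlog]
      rcases Nat.even_or_odd' n with ⟨k, hk | hk⟩
      · have hk' : n = 2 * m := by omega
        refine ⟨fun d => if d = l + 1 then 0 else f d, fun d => ?_, ?_⟩
        · dsimp only
          split_ifs
          · simp [coeffL1_zero]
          · exact hf d
        · rw [← step _ fun d hd => if_neg (by rw [Finset.mem_range] at hd; omega), if_pos rfl,
            add_zero, ← hS.onesPoly_two_mul, ← hk']
      · have hk' : n = 2 * m + 1 := by omega
        refine ⟨fun d => if d = l + 1 then X ^ S.ones (2 * m) else f d, fun d => ?_, ?_⟩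
        · dsimp only
          split_ifs with h
          · refine ⟨?_, (coeffL1_X_pow _).le⟩
            rw [natDegree_X_pow, h]
            have h3 := hS.ones_le m |>.1
            have h4 := hS.ones_le_log m
            omega
          · exact hf d
        · rw [← step _ fun d hd => if_neg (by rw [Finset.mem_range] at hd; omega), if_pos rfl,
            ← hS.onesPoly_two_mul]
          conv_lhs => rw [hk']
          simp only [onesPoly, Finset.sum_range_succ]

end BinaryCoding

/-! ### Identification of the Taylor coefficients -/

/-- The function `f / B ^ d`, where `B = (1 + X) / 2`. -/
noncomputable def polyQuotient (d : ℕ) (f : ℝ[X]) (y : ℝ) : ℝ :=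
  f.eval y * (((1 + y) / 2) ^ d)⁻¹

theorem analyticAt_polyQuotient (d : ℕ) (f : ℝ[X]) : AnalyticAt ℝ (polyQuotient d f) 1 := by
  have h1 : AnalyticAt ℝ (fun y : ℝ => f.eval y) 1 := by
    simpa using (analyticAt_id (𝕜 := ℝ) (z := (1 : ℝ))).aeval_polynomial f
  have h2 : AnalyticAt ℝ (fun y : ℝ => ((1 + y) / 2) ^ d) 1 := by fun_prop
  exact h1.mul (h2.inv (by norm_num))

theorem iteratedDeriv_succ_sub_mul {h : ℝ → ℝ} {a : ℝ} (hh : AnalyticAt ℝ h a) (r : ℕ) :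
    iteratedDeriv (r + 1) (fun y => (y - a) * h y) a = (r + 1) * iteratedDeriv r h a := by
  induction r generalizing h with
  | zero =>
    have := ((hasDerivAt_id a).sub_const a).fun_mul hh.differentiableAt.hasDerivAt
    simpa [iteratedDeriv_one] using this.deriv
  | succ r ih =>
    have hd : deriv (fun y => (y - a) * h y) =ᶠ[𝓝 a] fun y => h y + (y - a) * deriv h y := by
      filter_upwards [hh.eventually_analyticAt] with y hy
      have := ((hasDerivAt_id y).sub_const a).fun_mul hy.differentiableAt.hasDerivAt
      simpa using this.deriv
    have hs : AnalyticAt ℝ (fun y => (y - a) * deriv h y) a :=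
      AnalyticAt.mul (by fun_prop) hh.deriv
    rw [iteratedDeriv_succ', hd.iteratedDeriv_eq, iteratedDeriv_fun_add
      hh.contDiffAt hs.contDiffAt, ih hh.deriv, ← iteratedDeriv_succ']
    push_cast
    ring

/-- Near `1`, `f / B ^ d = f(1) + (y - 1) (slopePoly d f) / B ^ d`, so applying `slopePoly d` shifts
the Taylor coefficients by one. -/
theorem iteratedDeriv_polyQuotient (r d : ℕ) (f : ℝ[X]) :
    iteratedDeriv r (polyQuotient d f) 1 = r.factorial * ((slopePoly d)^[r] f).eval 1 := by
  induction r generalizing f with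
  | zero => simp [polyQuotient]
  | succ r ih =>
    have h : polyQuotient d f =ᶠ[𝓝 1]
        fun y => f.eval 1 + (y - 1) * polyQuotient d (slopePoly d f) y := by
      filter_upwards [lt_mem_nhds (show (0 : ℝ) < 1 by norm_num)] with y hy
      have e := congrArg (eval y) (X_sub_one_mul_slopePoly d f)
      simp only [eval_mul, eval_sub, eval_X, eval_C, eval_pow, eval_bitPoly] at e
      have hy' : ((1 + y) / 2) ^ d ≠ 0 := by positivity
      simp only [polyQuotient]
      rw [← mul_assoc, e, sub_mul, mul_assoc, mul_inv_cancel₀ hy']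
      ring
    have hs : AnalyticAt ℝ (fun y => (y - 1) * polyQuotient d (slopePoly d f) y) 1 :=
      AnalyticAt.mul (by fun_prop) (analyticAt_polyQuotient _ _)
    rw [h.iteratedDeriv_eq, iteratedDeriv_fun_add contDiffAt_const hs.contDiffAt,
      iteratedDeriv_succ_sub_mul (analyticAt_polyQuotient _ _), ih, iteratedDeriv_const,
      Nat.factorial_succ, Function.iterate_succ_apply]
    push_cast
    simp
    ring

/-- As `2 ^ ⌊log₂ n⌋ ≤ n`, the weights are at most `2 ^ (-d)`, and the geometric decay beats any
power of `d + 1`. -/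
theorem exists_sum_weights_le (p : ℕ) :
    ∃ W : ℝ, 0 ≤ W ∧ ∀ n : ℕ, 1 ≤ n → ∑ d ∈ Finset.range (Nat.log 2 n + 1),
      (2 : ℝ) ^ (Nat.log 2 n - d) / n * ((d : ℝ) + 1) ^ p ≤ W := by
  have hs : Summable fun d : ℕ => ((d : ℝ) + 1) ^ p * (1 / 2) ^ d := by
    have h := (summable_nat_add_iff 1).mpr
      (summable_pow_mul_geometric_of_norm_lt_one p (r := (1 / 2 : ℝ)) (by norm_num))
    refine (h.mul_left 2).congr fun d => ?_
    push_cast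
    ring
  refine ⟨_, tsum_nonneg fun d => by positivity, fun n hn =>
    (Finset.sum_le_sum fun d hd => ?_).trans (hs.sum_le_tsum _ fun d _ => by positivity)⟩
  rw [mul_comm]
  gcongr
  have hn0 : (0 : ℝ) < n := by exact_mod_cast hn
  rw [Finset.mem_range] at hd
  rw [div_le_iff₀ hn0, one_div, inv_pow, inv_mul_eq_div, le_div_iff₀ (by positivity), ← pow_add,
    Nat.sub_add_cancel (by omega)]
  exact_mod_cast Nat.pow_log_le_self 2 (by omega)

/-! ### Bounds for the coefficients and for the remainder -/

namespace BinaryCoding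

variable {S : BinaryCoding}

theorem quotient_eq (S : BinaryCoding) {n : ℕ} (hn : 1 ≤ n) :
    S.quotient n = polyQuotient (Nat.log 2 n) (C ((n : ℝ)⁻¹) * S.onesPoly n) := by
  ext y
  rw [quotient, S.pgf_eq hn, polyQuotient, eval_C_mul]
  ring

theorem coef_eq (S : BinaryCoding) (r : ℕ) {n : ℕ} (hn : 1 ≤ n) :
    S.coef r n = ((slopePoly (Nat.log 2 n))^[r] (S.onesPoly n)).eval 1 / n := by
  rw [coef, S.quotient_eq hn, iteratedDeriv_polyQuotient, iterate_slopePoly_C_mul, eval_C_mul]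
  field_simp

theorem eventually_hasSum_coef (S : BinaryCoding) {n : ℕ} (hn : 1 ≤ n) :
    ∀ᶠ y in 𝓝 (1 : ℝ), HasSum (fun r : ℕ => S.coef r n * (y - 1) ^ r)
      (S.pgf n y * (((1 + y) / 2) ^ Nat.log 2 n)⁻¹) := by
  have h : AnalyticAt ℝ (S.quotient n) 1 := by
    rw [S.quotient_eq hn]
    exact analyticAt_polyQuotient _ _
  have h2 := hasFPowerSeriesAt_iff'.mp h.hasFPowerSeriesAt
  filter_upwards [h2] with y hy
  simpa [coef, quotient, FormalMultilinearSeries.coeff_ofScalars, mul_comm] using hy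

theorem IsDoubling.coef_two_mul (hS : S.IsDoubling) (r : ℕ) {n : ℕ} (hn : 1 ≤ n) :
    S.coef r (2 * n) = S.coef r n := by
  have hP : S.onesPoly (2 * n) = C 2 * (S.onesPoly n * bitPoly ^ 1) := by
    have h2 : (C 2 * C (1 / 2) : ℝ[X]) = 1 := by
      rw [← C_mul, mul_one_div_cancel two_ne_zero, C_1]
    rw [hS.onesPoly_two_mul, bitPoly, pow_one]
    linear_combination -(S.onesPoly n * (1 + X)) * h2
  have hlog : Nat.log 2 (2 * n) = Nat.log 2 n + 1 := by
    rw [mul_comm, Nat.log_mul_base one_lt_two (by omega)]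
  rw [S.coef_eq r (by omega), S.coef_eq r hn, hP, hlog, iterate_slopePoly_C_mul,
    iterate_slopePoly_mul_bitPoly_pow, eval_C_mul, eval_mul, eval_pow, eval_bitPoly]
  push_cast
  field_simp
  norm_num
  ring

/-- Because powers of `B` pass through the operator, a block at depth `d` needs only `slopePoly d`
on a polynomial of degree at most `d + 1`. The bound is thus a power of `d + 1` rather than of `log₂
n`. -/
theorem IsDoubling.iterate_slopePoly_onesPoly (hS : S.IsDoubling) {n : ℕ} (hn : 1 ≤ n) :
    ∃ f : ℕ → ℝ[X], (∀ M d, coeffL1 ((slopePoly d)^[M] (f d)) ≤ 2 ^ M * ((d : ℝ) + 1) ^ M) ∧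
      ∀ M, (slopePoly (Nat.log 2 n))^[M] (S.onesPoly n)
        = ∑ d ∈ Finset.range (Nat.log 2 n + 1), C (2 ^ (Nat.log 2 n - d)) *
          ((slopePoly d)^[M] (f d) * bitPoly ^ (Nat.log 2 n - d)) := by
  obtain ⟨f, hf, hP⟩ := hS.onesPoly_eq_sum hn
  refine ⟨f, fun M d => ?_, fun M => ?_⟩
  · refine (coeffL1_iterate_slopePoly_le M (Nat.le_succ d) (hf d).1).trans ?_
    rw [mul_pow]
    push_cast
    exact mul_le_of_le_one_right (by positivity) (hf d).2
  · rw [hP, iterate_slopePoly_sum]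
    refine Finset.sum_congr rfl fun d hd => ?_
    rw [Finset.mem_range] at hd
    have hd' : d + (Nat.log 2 n - d) = Nat.log 2 n := by omega
    have e : f d * (1 + X) ^ (Nat.log 2 n - d)
        = C (2 ^ (Nat.log 2 n - d)) * (f d * bitPoly ^ (Nat.log 2 n - d)) := by
      rw [bitPoly_pow, mul_left_comm (f d), ← mul_assoc (C _), ← C_mul,
        mul_inv_cancel₀ (by positivity), C_1, one_mul]
    rw [e, iterate_slopePoly_C_mul, ← iterate_slopePoly_mul_bitPoly_pow, hd']

theorem exists_abs_coef_le (m : ℕ) :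
    ∃ K : ℝ, 0 ≤ K ∧ ∀ S : BinaryCoding, S.IsDoubling → ∀ n : ℕ, 1 ≤ n → |S.coef m n| ≤ K := by
  obtain ⟨W, hW, h⟩ := exists_sum_weights_le m
  refine ⟨2 ^ m * W, by positivity, fun S hS n hn => ?_⟩
  obtain ⟨f, hf, hP⟩ := hS.iterate_slopePoly_onesPoly hn
  rw [S.coef_eq m hn, hP, abs_div, Nat.abs_cast]
  calc _ ≤ (∑ d ∈ Finset.range (Nat.log 2 n + 1),
        (2 : ℝ) ^ (Nat.log 2 n - d) * (2 ^ m * ((d : ℝ) + 1) ^ m)) / n := by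
        gcongr
        refine (abs_eval_one_le_coeffL1 _).trans ((coeffL1_sum_le _ _).trans
          (Finset.sum_le_sum fun d _ => ?_))
        rw [coeffL1_C_mul, abs_of_nonneg (by positivity)]
        gcongr
        refine (coeffL1_mul_le _ _).trans ?_
        exact (mul_le_of_le_one_right (coeffL1_nonneg _)
          (coeffL1_pow_le_one coeffL1_bitPoly_le _)).trans (hf m d)
    _ = 2 ^ m * ∑ d ∈ Finset.range (Nat.log 2 n + 1),
        (2 : ℝ) ^ (Nat.log 2 n - d) / n * ((d : ℝ) + 1) ^ m := by
        rw [Finset.mul_sum, Finset.sum_div]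
        exact Finset.sum_congr rfl fun d _ => by ring
    _ ≤ _ := by gcongr; exact h n hn

theorem prob_sub_sum_eq (S : BinaryCoding) (M : ℕ) {n : ℕ} (hn : 1 ≤ n) (k : ℕ) :
    S.prob n k - ∑ r ∈ Finset.range M,
      (-1) ^ r * S.coef r n * (2 ^ Nat.log 2 n)⁻¹ * diffChoose r (Nat.log 2 n) k
    = ((X - C 1) ^ M * (slopePoly (Nat.log 2 n))^[M] (S.onesPoly n)).coeff k / n := by
  have h := congrArg (fun p : ℝ[X] => p.coeff k)
    (eq_sum_add_iterate_slopePoly M (Nat.log 2 n) (S.onesPoly n))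
  simp only [coeff_add, finsetSum_coeff, coeff_C_mul, coeff_X_sub_one_pow_mul_bitPoly_pow] at h
  rw [S.prob_eq hn, h, add_div, Finset.sum_div, add_comm, add_sub_assoc, add_eq_left, sub_eq_zero]
  refine Finset.sum_congr rfl fun r _ => ?_
  rw [S.coef_eq r hn]
  ring

/-- In each block the factor `(X - 1) ^ M` is paired with `B ^ (L - d)`, which gives decay `(M + L -
d) ^ (-M/2)`. Shallow blocks have the full decay, and deep ones have geometrically small weight. -/
theorem exists_expansionError_le {M : ℕ} (hM : 1 ≤ M) :
    ∃ K : ℝ, 0 ≤ K ∧ ∀ S : BinaryCoding, S.IsDoubling → ∀ n : ℕ, 2 ≤ n →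
      S.expansionError M n ≤ K / Real.sqrt (Nat.log 2 n) ^ M := by
  obtain ⟨W, hW, h⟩ := exists_sum_weights_le (M + M)
  obtain ⟨A, hA, hX⟩ := exists_coeffL1_X_sub_one_pow_le M
  refine ⟨2 ^ M * A * W, by positivity, fun S hS n hn => ?_⟩
  have hn1 : 1 ≤ n := by omega
  obtain ⟨f, hf, hP⟩ := hS.iterate_slopePoly_onesPoly hn1
  have hL : 1 ≤ Nat.log 2 n := Nat.log_pos one_lt_two hn
  simp only [expansionError, S.prob_sub_sum_eq M hn1, abs_div, Nat.abs_cast]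
  rw [← Finset.sum_div]
  set L := Nat.log 2 n
  have hL0 : (0 : ℝ) < L := by exact_mod_cast hL
  have hsq : 0 < Real.sqrt (L : ℝ) := Real.sqrt_pos.mpr hL0
  have hcmp : ∀ d ∈ Finset.range (L + 1), A / Real.sqrt ((M + (L - d) : ℕ) : ℝ) ^ M
      ≤ A * ((d : ℝ) + 1) ^ M / Real.sqrt L ^ M := by
    intro d hd
    rw [Finset.mem_range] at hd
    have h0 : 0 < Real.sqrt ((M + (L - d) : ℕ) : ℝ) :=
      Real.sqrt_pos.mpr (by exact_mod_cast (by omega : 0 < M + (L - d)))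
    -- Trades `L - d` for `L` at the price of a factor `d + 1`. Here `M ≥ 1` matters, for the
    -- deepest block `d = L`; the price, raised to the power `M`, accounts for the exponent `M + M`
    -- in the weights.
    have h1 : Real.sqrt (L : ℝ) ≤ ((d : ℝ) + 1) * Real.sqrt ((M + (L - d) : ℕ) : ℝ) := by
      rw [Real.sqrt_le_left (by positivity), mul_pow, Real.sq_sqrt (by positivity)]
      obtain ⟨t, ht⟩ : ∃ t, L = d + t := ⟨L - d, by omega⟩
      rw [ht, Nat.add_sub_cancel_left]
      have : d + t ≤ (d + 1) ^ 2 * (M + t) := by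
        nlinarith [Nat.zero_le (d * t), Nat.zero_le (d ^ 2 * t), Nat.zero_le (d ^ 2),
          Nat.mul_le_mul_left ((d + 1) ^ 2) hM]
      exact_mod_cast this
    rw [div_le_div_iff₀ (by positivity) (by positivity), mul_assoc, ← mul_pow]
    gcongr
  calc _ ≤ (∑ d ∈ Finset.range (L + 1), (2 : ℝ) ^ (L - d) *
        (2 ^ M * ((d : ℝ) + 1) ^ M * (A * ((d : ℝ) + 1) ^ M / Real.sqrt L ^ M))) / n := by
        refine div_le_div_of_nonneg_right ?_ (Nat.cast_nonneg n)
        refine (sum_range_abs_coeff_le_coeffL1 _ _).trans ?_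
        rw [hP, Finset.mul_sum]
        refine (coeffL1_sum_le _ _).trans (Finset.sum_le_sum fun d hd => ?_)
        rw [mul_left_comm, coeffL1_C_mul, abs_of_nonneg (by positivity), mul_left_comm _ _ (_ ^ _)]
        gcongr
        refine (coeffL1_mul_le _ _).trans ?_
        gcongr
        · exact coeffL1_nonneg _
        · exact hf M d
        · exact (hX _ (by omega)).trans (hcmp d hd)
    _ = 2 ^ M * A * (∑ d ∈ Finset.range (L + 1),
        (2 : ℝ) ^ (L - d) / n * ((d : ℝ) + 1) ^ (M + M)) / Real.sqrt L ^ M := by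
        rw [Finset.mul_sum, Finset.sum_div, Finset.sum_div]
        exact Finset.sum_congr rfl fun d _ => by rw [pow_add]; ring
    _ ≤ _ := by gcongr; exact h n hn1

end BinaryCoding

end

/-! ### The main theorem -/

theorem mainTheorem6 :
    (∀ S : BinaryCoding, S.IsDoubling →
      ∀ n : ℕ, 1 ≤ n →
        (∀ᶠ y in 𝓝 (1 : ℝ), HasSum (fun r : ℕ => S.coef r n * (y - 1) ^ r)
          (S.pgf n y * (((1 + y) / 2) ^ Nat.log 2 n)⁻¹)) ∧
        ∀ r : ℕ, S.coef r (2 * n) = S.coef r n) ∧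
    ∀ m : ℕ, 1 ≤ m → ∃ C : ℝ, ∀ S : BinaryCoding, S.IsDoubling → ∀ n : ℕ, 2 ≤ n →
      |S.expansionError m n
          - hermiteConst m * |S.coef m n| / (Nat.log 2 n : ℝ) ^ ((m : ℝ) / 2)|
        ≤ C * (Nat.log 2 n : ℝ) ^ (-(((m : ℝ) + 1) / 2)) := by
  refine ⟨fun S hS n hn => ⟨S.eventually_hasSum_coef hn, fun r => hS.coef_two_mul r hn⟩,
    fun m _ => ?_⟩
  obtain ⟨A, hA, h1⟩ := BinaryCoding.exists_expansionError_le (M := m + 1) (by omega)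
  obtain ⟨B, hB, h2⟩ := BinaryCoding.exists_abs_coef_le m
  obtain ⟨D, hD, h3⟩ := exists_sum_abs_diffChoose_sub_le m
  -- `A` bounds the remainder after `m + 1` terms; `B` bounds `|b_m(n)|`, uniformly in `n` and the
  -- coding, and multiplies the error `D` in the size of the `m`-th differences.
  refine ⟨A + B * D, fun S hS n hn => ?_⟩
  have h1' := h1 S hS n hn
  have h2' := h2 S hS n (by omega)
  have h3' := h3 (Nat.log 2 n) (Nat.log_pos one_lt_two hn)
  have hpow : ∀ j : ℕ, (Nat.log 2 n : ℝ) ^ ((j : ℝ) / 2) = Real.sqrt (Nat.log 2 n) ^ j := by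
    intro j
    rw [Real.sqrt_eq_rpow, ← Real.rpow_mul_natCast (Nat.cast_nonneg _)]
    ring_nf
  rw [Real.rpow_neg (Nat.cast_nonneg _), ← Nat.cast_add_one, hpow, hpow, ← div_eq_mul_inv]
  set T := ∑ k ∈ Finset.range (Nat.log 2 n + 1), (2 ^ Nat.log 2 n)⁻¹ *
    |diffChoose m (Nat.log 2 n) k| with hT
  -- The expansions with `m` and `m + 1` terms differ by the term `r = m`, whose `ℓ¹` size on `k ≤
  -- L` is `|b_m| T`; the reverse triangle inequality is applied for each `k`.
  have h4 : |S.expansionError m n - |S.coef m n| * T| ≤ S.expansionError (m + 1) n := by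
    rw [BinaryCoding.expansionError, BinaryCoding.expansionError, hT, Finset.mul_sum,
      ← Finset.sum_sub_distrib]
    refine (Finset.abs_sum_le_sum_abs _ _).trans (Finset.sum_le_sum fun k _ => ?_)
    rw [Finset.sum_range_succ, ← sub_sub]
    refine le_trans (le_of_eq ?_) (abs_abs_sub_abs_le_abs_sub _ _)
    congr 2
    rw [abs_mul, abs_mul, abs_mul, abs_pow, abs_neg, abs_one, one_pow, one_mul,
      abs_of_pos (by positivity : (0 : ℝ) < (2 ^ Nat.log 2 n)⁻¹)]
    ring
  have e : S.expansionError m n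
      - hermiteConst m * |S.coef m n| / Real.sqrt (Nat.log 2 n) ^ m
      = (S.expansionError m n - |S.coef m n| * T)
        + |S.coef m n| * (T - hermiteConst m / Real.sqrt (Nat.log 2 n) ^ m) := by ring
  rw [e, add_div, mul_div_assoc]
  refine (abs_add_le _ _).trans (add_le_add (h4.trans h1') ?_)
  rw [abs_mul, abs_abs]
  gcongr
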